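/- Let $q\in\mathbb{C}$ with $0<|q|<1$. Write $(x;q)_n:=\prod_{i=0}^{n-1}(1-q^i x)$ and $(x;q)_\infty:=\prod_{i\ge 0}(1-q^i x)$. For $x,z\in\mathbb{C}\setminus\{0\}$ define the theta function and, when no denominator vanishes, the Appell–Lerch function by $$j(x;q):=(x;q)_\infty(q/x;q)_\infty(q;q)_\infty,\qquad m(x,q,z):=\frac{1}{j(z;q)}\sum_{r=-\infty}^{\infty}\frac{(-1)^r q^{\binom{r}{2}}z^r}{1-q^{r-1}xz},$$ where $\binom r2=r(r-1)/2$. The tenth-order mock theta functions are $$\phi(q)=\sum_{n\ge 0}\frac{q^{\binom{n+1}{2}}}{(q;q^2)_{n+1}},\quad \psi(q)=\sum_{n\ge 0}\frac{q^{\binom{n+2}{2}}}{(q;q^2)_{n+1}},\quad X(q)=\sum_{n\ge 0}\frac{(-1)^nq^{n^2}}{(-q;q)_{2n}},\quad \chi(q)=\sum_{n\ge 0}\frac{(-1)^nq^{(n+1)^2}}{(-q;q)_{2n+1}}.$$ Then these four series converge absolutely, all the Appell–Lerch functions below are well defined (no denominator vanishes and the series converge absolutely), and $$\phi(q)=-q^{-1}\bigl(m(q,q^{10},q)+m(q,q^{10},q^2)\bigr),$$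 $$\psi(q)=-m(q^3,q^{10},q)-m(q^3,q^{10},q^3),$$ $$X(q)=m(-q^2,q^5,q)+m(-q^2,q^5,q^4),$$ $$\chi(q)=m(-q,q^5,q^2)+m(-q,q^5,q^3).$$ -/

import Mathlib

namespace MockTheta

noncomputable section

/-- The finite `q`-Pochhammer symbol `(x; q)_n = ∏_{i=0}^{n-1} (1 - q^i x)`. -/
def qPochhammer (x q : ℂ) (n : ℕ) : ℂ :=
  ∏ i ∈ Finset.range n, (1 - q ^ i * x)

/-- The infinite `q`-Pochhammer symbol `(x; q)_∞ = ∏_{i ≥ 0} (1 - q^i x)`, for `|q| < 1`. -/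
def qPochhammerInf (x q : ℂ) : ℂ :=
  ∏' i : ℕ, (1 - q ^ i * x)

/-- The theta function `j(x; q) = (x; q)_∞ (q/x; q)_∞ (q; q)_∞`, for `|q| < 1` and `x ≠ 0`. -/
def theta (x q : ℂ) : ℂ :=
  qPochhammerInf x q * qPochhammerInf (q / x) q * qPochhammerInf q q

/-- The `r`-th term `(-1)^r q^{r(r-1)/2} z^r / (1 - q^{r-1} x z)` of the Appell–Lerch series,
for an integer `r`. The integer division is exact, as `r (r - 1)` is even. -/
def appellLerchTerm (x q z : ℂ) (r : ℤ) : ℂ :=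
  (-1) ^ r * q ^ (r * (r - 1) / 2) * z ^ r / (1 - q ^ (r - 1) * x * z)

/-- The Appell–Lerch function
`m(x, q, z) = j(z; q)⁻¹ ∑_{r ∈ ℤ} (-1)^r q^{r(r-1)/2} z^r / (1 - q^{r-1} x z)`. -/
def appellLerch (x q z : ℂ) : ℂ :=
  1 / theta z q * ∑' r : ℤ, appellLerchTerm x q z r

/-- The expression defining `m(x, q, z)` is meaningful: no denominator vanishes and the
bilateral series converges (absolutely). -/
def AppellLerchDefined (x q z : ℂ) : Prop :=
  theta z q ≠ 0 ∧ (∀ r : ℤ, 1 - q ^ (r - 1) * x * z ≠ 0) ∧ Summable (appellLerchTerm x q z)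

/-- The terms of `φ(q) = ∑_{n ≥ 0} q^{n(n+1)/2} / (q; q²)_{n+1}`. -/
def phiTerm (q : ℂ) (n : ℕ) : ℂ :=
  q ^ (n + 1).choose 2 / qPochhammer q (q ^ 2) (n + 1)

/-- The terms of `ψ(q) = ∑_{n ≥ 0} q^{(n+1)(n+2)/2} / (q; q²)_{n+1}`. -/
def psiTerm (q : ℂ) (n : ℕ) : ℂ :=
  q ^ (n + 2).choose 2 / qPochhammer q (q ^ 2) (n + 1)

/-- The terms of `X(q) = ∑_{n ≥ 0} (-1)^n q^{n²} / (-q; q)_{2n}`. -/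
def bigXTerm (q : ℂ) (n : ℕ) : ℂ :=
  (-1) ^ n * q ^ (n ^ 2) / qPochhammer (-q) q (2 * n)

/-- The terms of `χ(q) = ∑_{n ≥ 0} (-1)^n q^{(n+1)²} / (-q; q)_{2n+1}`. -/
def chiTerm (q : ℂ) (n : ℕ) : ℂ :=
  (-1) ^ n * q ^ ((n + 1) ^ 2) / qPochhammer (-q) q (2 * n + 1)

/-- The tenth-order mock theta function `φ`. -/
def phi (q : ℂ) : ℂ := ∑' n : ℕ, phiTerm q n

/-- The tenth-order mock theta function `ψ`. -/
def psi (q : ℂ) : ℂ := ∑' n : ℕ, psiTerm q n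

/-- The tenth-order mock theta function `X`. -/
def bigX (q : ℂ) : ℂ := ∑' n : ℕ, bigXTerm q n

/-- The tenth-order mock theta function `χ`. -/
def chi (q : ℂ) : ℂ := ∑' n : ℕ, chiTerm q n

/-- The product defining `(x; q)_∞` converges whenever `|q| < 1`. -/
theorem multipliable_qPochhammerInf (x : ℂ) {q : ℂ} (hq : ‖q‖ < 1) :
    Multipliable fun i : ℕ => 1 - q ^ i * x := by
  have h : Summable fun i : ℕ => ‖-(q ^ i * x)‖ := by
    simpa [norm_mul, norm_pow] using
      (summable_geometric_of_lt_one (norm_nonneg q) hq).mul_right ‖x‖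
  simpa [sub_eq_add_neg] using multipliable_one_add_of_summable h

/-- `(x; q)_n ≠ 0` for `|x| < 1` and `|q| ≤ 1`; so the denominators in the four mock theta
series do not vanish. -/
theorem qPochhammer_ne_zero {x q : ℂ} (hx : ‖x‖ < 1) (hq : ‖q‖ ≤ 1) (n : ℕ) :
    qPochhammer x q n ≠ 0 := by
  refine Finset.prod_ne_zero_iff.2 fun i _ h => ?_
  have h1 : ‖q ^ i * x‖ = 1 := by rw [← sub_eq_zero.1 h, norm_one]
  have h2 : ‖q ^ i * x‖ ≤ ‖x‖ := by
    rw [norm_mul, norm_pow]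
    exact mul_le_of_le_one_left (norm_nonneg x) (pow_le_one₀ (norm_nonneg q) hq)
  linarith

end

end MockTheta

open Filter Topology

namespace MockTheta

noncomputable section

/-! Both sides are compared through a single sequence, T_n = ∑_{0 ≤ i < n} q^{i(n-1-i)}
(`heckeCoeff`).

On the mock theta side, β_n = (q)_n/(q)_{2n} and β_n = (q)_n/(q)_{2n+1} belong to Bailey pairs whose
α_r is built from T (`sum_baileyZero`, `sum_baileyOne`, `sum_baileyTwo`). A limiting Bailey lemma
(`hasSum_bailey`) then turns each mock theta function, up to infinite products, into the Hecke-type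
double sum f_{2,3,2}(x, x, ·) (`heckeSum`) at a special x.

On the Appell–Lerch side, j(x;q) m(q³/x, q⁵, q^a) is expanded in powers of x, using partial theta
functions. The normalised coefficients, summed over a and -a, form a sequence τ on ℤ with τ(n+4) = 2
+ q^{n+2} τ(n) and τ(-4-n) = -q^{n+2} τ(n). A sequence with t(n+2) = 2 + q^n t(n) and t(-n) = -q^n
t(n) is forced to be T on ℕ (`eq_heckeCoeff`), and there are two ways to make such a t from τ. In
base q², t(n) = τ(n-1) + q^{n-2} τ(n-3) gives `heckeSum_eq_add`, used for φ and ψ. In base q, t(n) =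
τ(2(n-1)) satisfies the conditions with q² for q and gives `heckeSum_sq_eq`, used for X and χ.

At the special x one of the two theta factors is zero and the other cancels the infinite products.
The symmetries `appellLerch_inv`, `appellLerch_mul_left` and `appellLerch_flip` bring the surviving
Appell–Lerch functions to the required arguments. -/

/-! ### Theta series and partial theta functions. -/

/-- `n(n-1)/2` as an integer. -/
def c2 (n : ℤ) : ℤ := n * (n - 1) / 2

theorem two_mul_c2 (n : ℤ) : 2 * c2 n = n * (n - 1) :=
  Int.mul_ediv_cancel' (Int.even_mul_pred_self n).two_dvd

theorem c2_add (m n : ℤ) : c2 (m + n) = c2 m + c2 n + m * n := by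
  have h1 := two_mul_c2 m
  have h2 := two_mul_c2 n
  have h3 := two_mul_c2 (m + n)
  linarith

theorem c2_one : c2 1 = 0 := rfl

theorem c2_zero : c2 0 = 0 := rfl

theorem c2_succ (n : ℤ) : c2 (n + 1) = c2 n + n := by
  rw [c2_add, c2_one]; ring

theorem c2_neg (n : ℤ) : c2 (-n) = c2 n + n := by
  have h1 := two_mul_c2 n
  have h2 := two_mul_c2 (-n)
  linarith

theorem c2_nat (n : ℕ) : c2 n = (n.choose 2 : ℕ) := by
  have h := two_mul_c2 n
  have h2 := Nat.choose_two_right n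
  have h3 : 2 * n.choose 2 = n * (n - 1) := by
    rw [h2]; exact Nat.mul_div_cancel' (Nat.even_mul_pred_self n).two_dvd
  rcases n with _ | n
  · simp [c2]
  · have h4 : (2 : ℤ) * ((n + 1).choose 2 : ℕ) = (n + 1) * n := by exact_mod_cast h3
    push_cast at h ⊢
    linarith

theorem summable_gauss_nat {q : ℂ} (hq1 : ‖q‖ < 1) (x : ℂ) :
    Summable fun n : ℕ => x ^ n * q ^ (n.choose 2) := by
  by_cases hx : x = 0
  · refine summable_of_ne_finset_zero (s := {0}) fun n hn => ?_
    simp only [Finset.mem_singleton] at hn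
    simp [hx, hn]
  by_cases hq0 : q = 0
  · refine summable_of_ne_finset_zero (s := {0, 1}) fun n hn => ?_
    have : n.choose 2 ≠ 0 := by
      simp only [Finset.mem_insert, Finset.mem_singleton, not_or] at hn
      exact (Nat.choose_pos (by omega)).ne'
    simp [hq0, this]
  refine summable_of_ratio_test_tendsto_lt_one (l := 0) one_pos
    (Eventually.of_forall fun n => by simp [hx, hq0]) ?_
  have h1 : Tendsto (fun n : ℕ => ‖x‖ * ‖q‖ ^ n) atTop (𝓝 (‖x‖ * 0)) :=
    (tendsto_pow_atTop_nhds_zero_of_lt_one (norm_nonneg q) hq1).const_mul _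
  rw [mul_zero] at h1
  refine h1.congr fun n => ?_
  have h2 : (n + 1).choose 2 = n + n.choose 2 := by
    rw [Nat.choose_succ_succ' n 1, Nat.choose_one_right]
  rw [h2, norm_mul, norm_mul, norm_pow, norm_pow, norm_pow, norm_pow]
  have hx' : ‖x‖ ≠ 0 := by simpa
  have hq' : ‖q‖ ≠ 0 := by simpa
  rw [pow_succ, pow_add]
  field_simp

theorem summable_gauss {q : ℂ} (hq0 : q ≠ 0) (hq1 : ‖q‖ < 1) {x : ℂ} (hx : x ≠ 0) :
    Summable fun n : ℤ => x ^ n * q ^ c2 n := by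
  refine Summable.of_nat_of_neg_add_one ?_ ?_
  · simpa [c2_nat] using summable_gauss_nat hq1 x
  · refine ((summable_gauss_nat hq1 (q * x⁻¹ * q)).mul_left (x⁻¹ * q)).congr fun n => ?_
    rw [c2_neg, c2_succ, c2_nat, mul_pow, mul_pow, zpow_neg, zpow_add₀ hq0, zpow_add₀ hq0,
      zpow_add₀ hq0, zpow_add₀ hx, inv_pow]
    simp only [zpow_natCast, zpow_one, mul_inv]
    ring

/-- The theta series `∑ (-1)^n q^{n(n-1)/2} x^n`. -/
def thetaSeries (x q : ℂ) : ℂ := ∑' n : ℤ, (-x) ^ n * q ^ c2 n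

theorem thetaSeries_mul_left {q : ℂ} (hq0 : q ≠ 0) {x : ℂ} (hx : x ≠ 0) :
    thetaSeries (q * x) q = -x⁻¹ * thetaSeries x q := by
  unfold thetaSeries
  rw [← (Equiv.addRight (1 : ℤ)).tsum_eq (fun n : ℤ => (-x) ^ n * q ^ c2 n), ← tsum_mul_left]
  refine tsum_congr fun n => ?_
  rw [Equiv.coe_addRight, c2_succ, zpow_add₀ hq0, zpow_add_one₀ (neg_ne_zero.2 hx),
    neg_mul_eq_mul_neg, mul_zpow]
  field_simp

theorem thetaSeries_inv {q : ℂ} (hq0 : q ≠ 0) {x : ℂ} (hx : x ≠ 0) :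
    thetaSeries x⁻¹ q = -x⁻¹ * thetaSeries x q := by
  rw [← thetaSeries_mul_left hq0 hx]
  unfold thetaSeries
  rw [← (Equiv.neg ℤ).tsum_eq (fun n : ℤ => (-x⁻¹) ^ n * q ^ c2 n)]
  refine tsum_congr fun n => ?_
  rw [Equiv.neg_apply, c2_neg, zpow_add₀ hq0, neg_mul_eq_mul_neg, mul_zpow, ← inv_zpow',
    ← inv_neg, inv_inv]
  ring

/-- The reflection n ↦ 1 - 2N - n preserves the exponent N n + n(n-1)/2 and reverses the sign
(-1)^n, so the terms cancel in pairs. -/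
theorem thetaSeries_zpow_eq_zero {q : ℂ} (hq0 : q ≠ 0) (N : ℤ) : thetaSeries (q ^ N) q = 0 := by
  have h : thetaSeries (q ^ N) q = -thetaSeries (q ^ N) q := by
    conv_lhs => rw [thetaSeries, ← (Equiv.subLeft (1 - 2 * N)).tsum_eq]
    rw [thetaSeries, ← tsum_neg]
    refine tsum_congr fun n => ?_
    have h1 : (-1 : ℂ) ^ (1 - 2 * N - n) = -(-1) ^ n := by
      rw [zpow_sub₀ (by norm_num), zpow_sub₀ (by norm_num), zpow_mul]
      rcases Int.even_or_odd n with hn | hn <;> simp [hn.neg_one_zpow]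
    have h2 : N * (1 - 2 * N - n) + c2 (1 - 2 * N - n) = N * n + c2 n := by
      have h3 := two_mul_c2 n
      have h4 := two_mul_c2 (1 - 2 * N - n)
      linarith
    rw [Equiv.subLeft_apply, neg_eq_neg_one_mul (q ^ N), mul_zpow, mul_zpow, h1, mul_assoc,
      mul_assoc, ← zpow_mul, ← zpow_mul, ← zpow_add₀ hq0, ← zpow_add₀ hq0, h2, neg_mul]
  exact self_eq_neg.1 h

/-- The partial theta function `∑_{l ≥ 0} (-1)^l q^{l(l-1)/2 + N l}`. -/
def partialTheta (q : ℂ) (N : ℤ) : ℂ := ∑' l : ℕ, (-q ^ N) ^ l * q ^ l.choose 2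

theorem choose_succ_two (n : ℕ) : (n + 1).choose 2 = n + n.choose 2 := by
  rw [Nat.choose_succ_succ' n 1, Nat.choose_one_right]

theorem partialTheta_eq {q : ℂ} (hq0 : q ≠ 0) (hq1 : ‖q‖ < 1) (N : ℤ) :
    partialTheta q N = 1 - q ^ N * partialTheta q (N + 1) := by
  rw [partialTheta, (summable_gauss_nat hq1 _).tsum_eq_zero_add, partialTheta, ← tsum_mul_left,
    sub_eq_add_neg, ← tsum_neg]
  congr 1
  · simp
  refine tsum_congr fun n => ?_
  rw [choose_succ_two, zpow_add_one₀ hq0, pow_add q, pow_succ (-q ^ N), ← neg_mul (q ^ N) q,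
    mul_pow]
  ring

theorem gauss_neg_succ {q : ℂ} (hq0 : q ≠ 0) (N : ℤ) (n : ℕ) :
    (-q ^ N) ^ (-((n : ℤ) + 1)) * q ^ c2 (-((n : ℤ) + 1)) =
      -q ^ (1 - N) * ((-q ^ (2 - N)) ^ n * q ^ n.choose 2) := by
  have e1 : (-q ^ N) ^ (-((n : ℤ) + 1)) = (-1) ^ (n + 1) * q ^ (-N * (n + 1)) := by
    rw [zpow_neg, neg_eq_neg_one_mul (q ^ N), mul_zpow, mul_inv, ← zpow_mul, ← zpow_neg,
      ← zpow_neg, ← neg_mul, ← Nat.cast_succ, zpow_neg, ← inv_zpow, zpow_natCast]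
    norm_num
  have e2 : (-q ^ (2 - N)) ^ n = (-1) ^ n * q ^ ((2 - N) * n) := by
    rw [neg_pow, zpow_mul, zpow_natCast]
  have e3 : -N * (n + 1) + c2 (-((n : ℤ) + 1)) = 1 - N + ((2 - N) * n + c2 n) := by
    rw [c2_neg, c2_succ]; ring
  rw [e1, e2, ← zpow_natCast q (n.choose 2), ← c2_nat, mul_assoc, mul_assoc, ← zpow_add₀ hq0,
    ← zpow_add₀ hq0, e3, zpow_add₀ hq0 (1 - N)]
  ring

/-- The bilateral series at q^N vanishes, so its nonnegative half is minus its negative half;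
reindexed, the latter is a partial theta function at 2 - N. -/
theorem partialTheta_symm {q : ℂ} (hq0 : q ≠ 0) (hq1 : ‖q‖ < 1) (N : ℤ) :
    partialTheta q N = q ^ (1 - N) * partialTheta q (2 - N) := by
  have hN : (-q ^ N) ≠ 0 := neg_ne_zero.2 (zpow_ne_zero _ hq0)
  have h := thetaSeries_zpow_eq_zero hq0 N
  have hs := summable_gauss hq0 hq1 hN
  have h1 : ∀ n : ℕ, (-q ^ N) ^ (n : ℤ) * q ^ c2 (n : ℤ) = (-q ^ N) ^ n * q ^ n.choose 2 :=
    fun n => by rw [c2_nat, zpow_natCast, zpow_natCast]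
  have hs1 : Summable fun n : ℕ => (-q ^ N) ^ (n : ℤ) * q ^ c2 (n : ℤ) :=
    hs.comp_injective Nat.cast_injective
  have hs2 : Summable fun n : ℕ => (-q ^ N) ^ (-((n : ℤ) + 1)) * q ^ c2 (-((n : ℤ) + 1)) :=
    hs.comp_injective (i := fun n : ℕ => -((n : ℤ) + 1)) fun a b hab => by simpa using hab
  have h3 := tsum_of_nat_of_neg_add_one (f := fun n : ℤ => (-q ^ N) ^ n * q ^ c2 n) hs1 hs2
  rw [tsum_congr h1, tsum_congr (gauss_neg_succ hq0 N), tsum_mul_left, ← thetaSeries, h,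
    ← partialTheta, ← partialTheta, neg_mul, ← sub_eq_add_neg] at h3
  exact sub_eq_zero.1 h3.symm

/-- For N ≥ 0 the Gaussian series dominates; for N ≤ 0 the reflection N ↦ 2 - N has the factor
q^{1-N}, of norm at most 1. Uniformity over ℤ justifies every later interchange of sums. -/
theorem norm_partialTheta_le {q : ℂ} (hq0 : q ≠ 0) (hq1 : ‖q‖ < 1) :
    ∃ C : ℝ, ∀ N, ‖partialTheta q N‖ ≤ C := by
  have hs : Summable fun l : ℕ => ‖q ^ l.choose 2‖ := by
    simpa using (summable_gauss_nat hq1 1).norm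
  have hpow : ∀ N : ℤ, 0 ≤ N → ‖q ^ N‖ ≤ 1 := fun N hN => by
    lift N to ℕ using hN
    rw [zpow_natCast, norm_pow]
    exact pow_le_one₀ (norm_nonneg _) hq1.le
  have key : ∀ N : ℤ, 0 ≤ N → ‖partialTheta q N‖ ≤ ∑' l : ℕ, ‖q ^ l.choose 2‖ := fun N hN => by
    refine tsum_of_norm_bounded hs.hasSum fun l => ?_
    rw [norm_mul, norm_pow, norm_neg]
    exact mul_le_of_le_one_left (norm_nonneg _) (pow_le_one₀ (norm_nonneg _) (hpow N hN))
  refine ⟨∑' l : ℕ, ‖q ^ l.choose 2‖, fun N => ?_⟩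
  rcases le_total 0 N with hN | hN
  · exact key N hN
  · rw [partialTheta_symm hq0 hq1, norm_mul]
    exact (mul_le_of_le_one_left (norm_nonneg _) (hpow _ (by omega))).trans (key _ (by omega))

theorem summable_gauss_mul_partialTheta {q : ℂ} (hq0 : q ≠ 0) (hq1 : ‖q‖ < 1) {x : ℂ}
    (hx : x ≠ 0) (k : ℤ) : Summable fun n : ℤ => (-x) ^ n * q ^ c2 n * partialTheta q (n + k) := by
  obtain ⟨C, hC⟩ := norm_partialTheta_le hq0 hq1
  refine Summable.of_norm_bounded ((summable_gauss hq0 hq1 (neg_ne_zero.2 hx)).norm.mul_right C)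
    fun n => ?_
  rw [norm_mul]
  gcongr
  exact hC _

/-- By `partialTheta_eq` and the shift n ↦ n + 1, the sum S satisfies S = j(x) + (q^k/x) S. This
replaces the geometric expansion of 1/(1 - q^k/x) and needs no condition on |x|. -/
theorem tsum_gauss_mul_partialTheta {q : ℂ} (hq0 : q ≠ 0) (hq1 : ‖q‖ < 1) {x : ℂ} (hx : x ≠ 0)
    {k : ℤ} (hk : 1 - q ^ k / x ≠ 0) :
    ∑' n : ℤ, (-x) ^ n * q ^ c2 n * partialTheta q (n + k) =
      thetaSeries x q / (1 - q ^ k / x) := by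
  rw [eq_div_iff hk]
  have hx' := neg_ne_zero.2 hx
  have h : ∑' n : ℤ, (-x) ^ n * q ^ c2 n * partialTheta q (n + k) =
      thetaSeries x q + q ^ k / x *
        ∑' n : ℤ, (-x) ^ n * q ^ c2 n * partialTheta q (n + k) := by
    conv_rhs => rw [← (Equiv.addRight (1 : ℤ)).tsum_eq
      (fun n : ℤ => (-x) ^ n * q ^ c2 n * partialTheta q (n + k))]
    rw [thetaSeries, ← tsum_mul_left, ← (summable_gauss hq0 hq1 hx').tsum_add]
    · refine tsum_congr fun n => ?_
      rw [Equiv.coe_addRight, partialTheta_eq hq0 hq1, c2_succ, zpow_add₀ hq0, zpow_add₀ hq0,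
        zpow_add_one₀ hx', add_right_comm n k 1]
      field_simp
      ring
    · exact (((Equiv.addRight (1 : ℤ)).summable_iff).2
        (summable_gauss_mul_partialTheta hq0 hq1 hx k)).mul_left _
  rw [mul_sub, mul_one, sub_eq_iff_eq_add]
  linear_combination h

/-! ### Pochhammer symbols and the Jacobi triple product. -/

theorem qPochhammer_zero (x q : ℂ) : qPochhammer x q 0 = 1 := by simp [qPochhammer]

theorem qPochhammer_succ (x q : ℂ) (n : ℕ) :
    qPochhammer x q (n + 1) = qPochhammer x q n * (1 - q ^ n * x) :=
  Finset.prod_range_succ _ _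

theorem tendsto_qPochhammer {q : ℂ} (hq1 : ‖q‖ < 1) (x : ℂ) :
    Tendsto (qPochhammer x q) atTop (𝓝 (qPochhammerInf x q)) :=
  (multipliable_qPochhammerInf x hq1).hasProd.tendsto_prod_nat

theorem qPochhammerInf_ne_zero {q : ℂ} (hq1 : ‖q‖ < 1) {x : ℂ}
    (hx : ∀ i : ℕ, 1 - q ^ i * x ≠ 0) : qPochhammerInf x q ≠ 0 := by
  have h : Summable fun i : ℕ => ‖-(q ^ i * x)‖ := by
    simpa [norm_mul, norm_pow] using
      (summable_geometric_of_lt_one (norm_nonneg q) hq1).mul_right ‖x‖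
  simp only [sub_eq_add_neg] at hx
  simpa [qPochhammerInf, sub_eq_add_neg] using tprod_one_add_ne_zero_of_summable hx h

theorem one_sub_pow_mul_ne_zero {q : ℂ} (hq1 : ‖q‖ < 1) {x : ℂ} (hx : ‖x‖ < 1) (i : ℕ) :
    1 - q ^ i * x ≠ 0 := by
  intro h
  have h1 : ‖q ^ i * x‖ = 1 := by rw [← sub_eq_zero.1 h, norm_one]
  have h2 : ‖q ^ i * x‖ ≤ ‖x‖ := by
    rw [norm_mul, norm_pow]
    exact mul_le_of_le_one_left (norm_nonneg x) (pow_le_one₀ (norm_nonneg q) hq1.le)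
  linarith

theorem qPochhammerInf_self_ne_zero {q : ℂ} (hq1 : ‖q‖ < 1) : qPochhammerInf q q ≠ 0 :=
  qPochhammerInf_ne_zero hq1 (one_sub_pow_mul_ne_zero hq1 hq1)

theorem norm_qPochhammer_le {q : ℂ} (hq1 : ‖q‖ < 1) (x : ℂ) :
    ∃ C : ℝ, ∀ n, ‖qPochhammer x q n‖ ≤ C := by
  obtain ⟨C, hC⟩ := (tendsto_qPochhammer hq1 x).norm.bddAbove_range
  exact ⟨C, fun n => hC ⟨n, rfl⟩⟩

/-- `1 / (q; q)_m`, extended by zero to negative integers. -/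
def invPoch (q : ℂ) (m : ℤ) : ℂ := if m < 0 then 0 else (qPochhammer q q m.toNat)⁻¹

theorem invPoch_of_neg (q : ℂ) {m : ℤ} (hm : m < 0) : invPoch q m = 0 := if_pos hm

theorem invPoch_natCast (q : ℂ) (n : ℕ) : invPoch q n = (qPochhammer q q n)⁻¹ := by
  simp [invPoch]

theorem invPoch_zero (q : ℂ) : invPoch q 0 = 1 := by
  simpa [qPochhammer_zero] using invPoch_natCast q 0

theorem one_sub_pow_ne_zero {q : ℂ} (hq1 : ‖q‖ < 1) (n : ℕ) : 1 - q ^ (n + 1) ≠ 0 := by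
  rw [pow_succ]
  exact one_sub_pow_mul_ne_zero hq1 hq1 n

theorem invPoch_sub_one {q : ℂ} (hq1 : ‖q‖ < 1) (m : ℤ) :
    invPoch q (m - 1) = (1 - q ^ m) * invPoch q m := by
  rcases lt_trichotomy m 0 with hm | rfl | hm
  · rw [invPoch_of_neg q hm, invPoch_of_neg q (by omega), mul_zero]
  · rw [invPoch_of_neg q (by omega), zpow_zero, sub_self, zero_mul]
  · obtain ⟨n, rfl⟩ : ∃ n : ℕ, m = n + 1 := ⟨(m - 1).toNat, by omega⟩
    rw [add_sub_cancel_right, invPoch_natCast, ← Nat.cast_succ, invPoch_natCast, zpow_natCast,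
      qPochhammer_succ, ← pow_succ, mul_inv, mul_left_comm, mul_inv_cancel₀, mul_one]
    exact one_sub_pow_ne_zero hq1 n

theorem invPoch_eq {q : ℂ} (hq1 : ‖q‖ < 1) (m : ℤ) :
    invPoch q m = (1 - q ^ (m + 1)) * invPoch q (m + 1) := by
  rw [← invPoch_sub_one hq1, add_sub_cancel_right]

theorem tendsto_invPoch {q : ℂ} (hq1 : ‖q‖ < 1) :
    Tendsto (invPoch q) atTop (𝓝 (qPochhammerInf q q)⁻¹) := by
  have h := (tendsto_qPochhammer hq1 q).inv₀ (qPochhammerInf_self_ne_zero hq1)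
  have ht : Tendsto Int.toNat atTop atTop := tendsto_atTop.2 fun n => by
    filter_upwards [eventually_ge_atTop (n : ℤ)] with m hm
    omega
  refine (h.comp ht).congr' ?_
  filter_upwards [eventually_ge_atTop 0] with m hm
  simp [invPoch, not_lt.2 hm]

theorem norm_invPoch_le {q : ℂ} (hq1 : ‖q‖ < 1) :
    ∃ C : ℝ, 0 ≤ C ∧ ∀ m, ‖invPoch q m‖ ≤ C := by
  have h := (tendsto_qPochhammer hq1 q).inv₀ (qPochhammerInf_self_ne_zero hq1)
  obtain ⟨C, hC⟩ := h.norm.bddAbove_range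
  have hC0 : 0 ≤ C := (norm_nonneg _).trans (hC ⟨0, rfl⟩)
  refine ⟨C, hC0, fun m => ?_⟩
  rw [invPoch]
  split_ifs
  · simpa
  · exact hC ⟨m.toNat, rfl⟩

theorem summable_gauss_mul_bounded {q : ℂ} (hq0 : q ≠ 0) (hq1 : ‖q‖ < 1) {x : ℂ} (hx : x ≠ 0)
    {f : ℤ → ℂ} {C : ℝ} (hf : ∀ n, ‖f n‖ ≤ C) : Summable fun n => x ^ n * q ^ c2 n * f n := by
  refine Summable.of_norm_bounded ((summable_gauss hq0 hq1 hx).norm.mul_right C) fun n => ?_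
  rw [norm_mul]
  gcongr
  exact hf n

/-- The finite form of the Jacobi triple product. -/
theorem tsum_gauss_mul_invPoch {q : ℂ} (hq0 : q ≠ 0) (hq1 : ‖q‖ < 1) {x : ℂ} (hx : x ≠ 0)
    (M N : ℕ) :
    ∑' n : ℤ, (-x) ^ n * q ^ c2 n * (invPoch q (M - n) * invPoch q (N + n)) =
      invPoch q (M + N) * (qPochhammer x q M * qPochhammer (q / x) q N) := by
  have hx' := neg_ne_zero.2 hx
  obtain ⟨C, hC0, hC⟩ := norm_invPoch_le hq1
  have hs : ∀ M N : ℤ, Summable fun n : ℤ =>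
      (-x) ^ n * q ^ c2 n * (invPoch q (M - n) * invPoch q (N + n)) := fun M N =>
    summable_gauss_mul_bounded hq0 hq1 hx' (C := C * C) fun n => by
      rw [norm_mul]; exact mul_le_mul (hC _) (hC _) (norm_nonneg _) hC0
  have hne : ∀ M N : ℕ, 1 - q ^ ((M : ℤ) + N + 1) ≠ 0 := fun M N => by
    have := one_sub_pow_ne_zero hq1 (M + N)
    exact_mod_cast this
  -- Rests on 1 - q^{M+N+1} = (1 - q^{M+1-n}) + q^{M+1-n}(1 - q^{N+n}): each bracket lowers one
  -- index of `invPoch`, and the second sum is a shift of the first. `hN` uses the mirror splitting.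
  have hM : ∀ M N : ℤ,
      (1 - q ^ (M + N + 1)) *
        ∑' n : ℤ, (-x) ^ n * q ^ c2 n * (invPoch q (M + 1 - n) * invPoch q (N + n)) =
      (1 - q ^ M * x) * ∑' n : ℤ, (-x) ^ n * q ^ c2 n * (invPoch q (M - n) * invPoch q (N + n)) :=
    fun M N => by
    have e : ∀ n : ℤ, (1 - q ^ (M + N + 1)) *
        ((-x) ^ n * q ^ c2 n * (invPoch q (M + 1 - n) * invPoch q (N + n))) =
        (-x) ^ n * q ^ c2 n * (invPoch q (M - n) * invPoch q (N + n)) +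
        (-x) ^ n * q ^ c2 n * q ^ (M + 1 - n) *
          (invPoch q (M + 1 - n) * invPoch q (N + n - 1)) := fun n => by
      rw [invPoch_sub_one hq1 (N + n), show M - n = M + 1 - n - 1 by ring,
        invPoch_sub_one hq1 (M + 1 - n), show M + N + 1 = (M + 1 - n) + (N + n) by ring,
        zpow_add₀ hq0 (M + 1 - n)]
      ring
    have e2 : ∀ n : ℤ, (-x) ^ (n + 1) * q ^ c2 (n + 1) * q ^ (M + 1 - (n + 1)) *
          (invPoch q (M + 1 - (n + 1)) * invPoch q (N + (n + 1) - 1)) = -(q ^ M * x) *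
          ((-x) ^ n * q ^ c2 n * (invPoch q (M - n) * invPoch q (N + n))) := fun n => by
      rw [show M + 1 - (n + 1) = M - n by ring, show N + (n + 1) - 1 = N + n by ring, c2_succ,
        zpow_add₀ hq0, zpow_sub₀ hq0, zpow_add_one₀ hx']
      field_simp
    rw [← tsum_mul_left, tsum_congr e, Summable.tsum_add (hs M N), sub_mul, one_mul,
      sub_eq_add_neg]
    · rw [← (Equiv.addRight (1 : ℤ)).tsum_eq (fun n : ℤ => (-x) ^ n * q ^ c2 n *
        q ^ (M + 1 - n) * _)]
      simp only [Equiv.coe_addRight]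
      rw [tsum_congr e2, tsum_mul_left, neg_mul]
    · rw [← (Equiv.addRight (1 : ℤ)).summable_iff]
      exact ((hs M N).mul_left _).congr fun n => (e2 n).symm
  have hN : ∀ M N : ℤ,
      (1 - q ^ (M + N + 1)) *
        ∑' n : ℤ, (-x) ^ n * q ^ c2 n * (invPoch q (M - n) * invPoch q (N + 1 + n)) =
      (1 - q ^ N * (q / x)) *
        ∑' n : ℤ, (-x) ^ n * q ^ c2 n * (invPoch q (M - n) * invPoch q (N + n)) :=
    fun M N => by
    have e : ∀ n : ℤ, (1 - q ^ (M + N + 1)) *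
        ((-x) ^ n * q ^ c2 n * (invPoch q (M - n) * invPoch q (N + 1 + n))) =
        (-x) ^ n * q ^ c2 n * (invPoch q (M - n) * invPoch q (N + n)) +
        (-x) ^ n * q ^ c2 n * q ^ (N + 1 + n) *
          (invPoch q (M - n - 1) * invPoch q (N + 1 + n)) := fun n => by
      rw [invPoch_sub_one hq1 (M - n), show N + n = N + 1 + n - 1 by ring,
        invPoch_sub_one hq1 (N + 1 + n), show M + N + 1 = (M - n) + (N + 1 + n) by ring,
        zpow_add₀ hq0 (M - n)]
      ring
    have e2 : ∀ n : ℤ, -(q ^ N * (q / x)) *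
          ((-x) ^ (n + 1) * q ^ c2 (n + 1) * (invPoch q (M - (n + 1)) * invPoch q (N + (n + 1))))
          = (-x) ^ n * q ^ c2 n * q ^ (N + 1 + n) *
          (invPoch q (M - n - 1) * invPoch q (N + 1 + n)) := fun n => by
      rw [show M - (n + 1) = M - n - 1 by ring, show N + (n + 1) = N + 1 + n by ring, c2_succ,
        zpow_add₀ hq0, zpow_add₀ hq0 (N + 1), zpow_add_one₀ hq0, zpow_add_one₀ hx']
      field_simp
    rw [← tsum_mul_left, tsum_congr e, Summable.tsum_add (hs M N), sub_mul, one_mul,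
      sub_eq_add_neg]
    · congr 1
      rw [← (Equiv.addRight (1 : ℤ)).tsum_eq (fun n : ℤ => (-x) ^ n * q ^ c2 n *
        (invPoch q (M - n) * _)), ← neg_mul, ← tsum_mul_left]
      exact tsum_congr fun n => (e2 n).symm
    · refine Summable.congr ?_ e2
      exact (((Equiv.addRight (1 : ℤ)).summable_iff).2 (hs M N)).mul_left _
  induction M with
  | zero =>
    induction N with
    | zero =>
      rw [tsum_eq_single 0]
      · simp [qPochhammer_zero, invPoch_zero, c2_zero]
      · intro n hn
        rcases lt_or_gt_of_ne hn with h | h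
        · rw [invPoch_of_neg q (m := ((0 : ℕ) : ℤ) + n) (by simpa using h)]; simp
        · rw [invPoch_of_neg q (m := ((0 : ℕ) : ℤ) - n) (by simpa using h)]; simp
    | succ N ih =>
      refine mul_left_cancel₀ (hne 0 N) ?_
      push_cast at ih ⊢
      rw [hN, ih, qPochhammer_succ, ← add_assoc, invPoch_eq hq1 (0 + N), zpow_natCast]
      ring
  | succ M ih =>
    refine mul_left_cancel₀ (hne M N) ?_
    push_cast at ih ⊢
    rw [hM, ih, qPochhammer_succ, add_right_comm, invPoch_eq hq1 (M + N), zpow_natCast]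
    ring_nf

/-- The Jacobi triple product identity. -/
theorem theta_eq_thetaSeries {q : ℂ} (hq0 : q ≠ 0) (hq1 : ‖q‖ < 1) {x : ℂ} (hx : x ≠ 0) :
    theta x q = thetaSeries x q := by
  have hx' := neg_ne_zero.2 hx
  have hQ := qPochhammerInf_self_ne_zero hq1
  obtain ⟨C, hC0, hC⟩ := norm_invPoch_le hq1
  have hcast : Tendsto (fun N : ℕ => (N : ℤ)) atTop atTop := tendsto_natCast_atTop_atTop
  -- The finite identity is taken with M = N → ∞.
  have h1 : Tendsto (fun N : ℕ => ∑' n : ℤ, (-x) ^ n * q ^ c2 n *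
      (invPoch q (N - n) * invPoch q (N + n))) atTop (𝓝 (∑' n : ℤ, (-x) ^ n * q ^ c2 n *
      ((qPochhammerInf q q)⁻¹ * (qPochhammerInf q q)⁻¹))) := by
    refine tendsto_tsum_of_dominated_convergence
      ((summable_gauss hq0 hq1 hx').norm.mul_right (C * C)) (fun n => ?_)
      (Eventually.of_forall fun N n => ?_)
    · refine Tendsto.const_mul _ (Tendsto.mul ?_ ?_)
      · exact (tendsto_invPoch hq1).comp (tendsto_atTop_add_const_right _ (-n) hcast)
      · exact (tendsto_invPoch hq1).comp (tendsto_atTop_add_const_right _ n hcast)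
    · rw [norm_mul, norm_mul (invPoch q _)]
      exact mul_le_mul_of_nonneg_left (mul_le_mul (hC _) (hC _) (norm_nonneg _) hC0)
        (norm_nonneg _)
  have h2 : Tendsto (fun N : ℕ => invPoch q (N + N) *
      (qPochhammer x q N * qPochhammer (q / x) q N)) atTop (𝓝 ((qPochhammerInf q q)⁻¹ *
      (qPochhammerInf x q * qPochhammerInf (q / x) q))) :=
    ((tendsto_invPoch hq1).comp (hcast.atTop_add_atTop hcast)).mul
      ((tendsto_qPochhammer hq1 x).mul (tendsto_qPochhammer hq1 (q / x)))
  have h3 := tendsto_nhds_unique h1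
    (h2.congr fun N => (tsum_gauss_mul_invPoch hq0 hq1 hx N N).symm)
  rw [tsum_mul_right, ← thetaSeries] at h3
  rw [theta]
  field_simp at h3
  linear_combination -h3

/-! ### Laurent coefficients of a theta function times an Appell–Lerch sum. -/

theorem pow_natCast_zpow (q : ℂ) (k : ℕ) (n : ℤ) : (q ^ k) ^ n = q ^ (k * n) := by
  rw [zpow_mul, zpow_natCast]

theorem norm_pow_lt_one {q : ℂ} (hq1 : ‖q‖ < 1) {k : ℕ} (hk : k ≠ 0) : ‖q ^ k‖ < 1 := by
  rw [norm_pow]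
  exact pow_lt_one₀ (norm_nonneg q) hq1 hk

theorem summable_gauss_mul_gauss {b q : ℂ} (hb0 : b ≠ 0) (hb1 : ‖b‖ < 1) (hq0 : q ≠ 0)
    (hq1 : ‖q‖ < 1) {x y : ℂ} (hx : x ≠ 0) (hy : y ≠ 0) {f : ℤ → ℤ → ℂ} {C : ℝ}
    (hf : ∀ r n, ‖f r n‖ ≤ C) :
    Summable fun p : ℤ × ℤ => x ^ p.1 * b ^ c2 p.1 * (y ^ p.2 * q ^ c2 p.2 * f p.1 p.2) := by
  refine Summable.of_norm_bounded (((summable_gauss hb0 hb1 hx).norm.mul_of_nonneg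
    (summable_gauss hq0 hq1 hy).norm (fun _ => norm_nonneg _)
    (fun _ => norm_nonneg _)).mul_right C) fun p => ?_
  rw [norm_mul, norm_mul (_ * _) (f _ _), ← mul_assoc]
  gcongr
  exact hf _ _

theorem appellLerchTerm_eq (x q z : ℂ) (r : ℤ) :
    appellLerchTerm x q z r = (-z) ^ r * q ^ c2 r / (1 - q ^ (r - 1) * x * z) := by
  rw [appellLerchTerm, neg_eq_neg_one_mul z, mul_zpow, c2]
  ring

/-- The coefficients, up to a Gaussian factor, of the Laurent expansion in `x` of
`j(x; q) j(q^a; q⁵) m(q³/x, q⁵, q^a)`. -/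
def lerchCoeff (q : ℂ) (a n : ℤ) : ℂ :=
  ∑' r : ℤ, (-q ^ a) ^ r * (q ^ 5) ^ c2 r * partialTheta q (n - 2 + a + 5 * r)

theorem summable_lerchCoeff {q : ℂ} (hq0 : q ≠ 0) (hq1 : ‖q‖ < 1) (a n : ℤ) :
    Summable fun r : ℤ =>
      (-q ^ a) ^ r * (q ^ 5) ^ c2 r * partialTheta q (n - 2 + a + 5 * r) := by
  obtain ⟨C, hC⟩ := norm_partialTheta_le hq0 hq1
  exact summable_gauss_mul_bounded (pow_ne_zero 5 hq0) (norm_pow_lt_one hq1 (by norm_num))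
    (neg_ne_zero.2 (zpow_ne_zero _ hq0)) fun r => hC _

/-- One step of `partialTheta_eq` raises the index by 1; with the shift by 4 in n this makes 5,
which the substitution r ↦ r + 1 absorbs. This is why base q⁵ goes with step four. -/
theorem lerchCoeff_add_four {q : ℂ} (hq0 : q ≠ 0) (hq1 : ‖q‖ < 1) (a n : ℤ) :
    lerchCoeff q a (n + 4) = thetaSeries (q ^ a) (q ^ 5) + q ^ (n + 2) * lerchCoeff q a n := by
  have hs := summable_lerchCoeff hq0 hq1 a n
  have hz : (-q ^ a) ≠ 0 := neg_ne_zero.2 (zpow_ne_zero _ hq0)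
  have hs' : Summable fun r : ℤ => q ^ (n + 2) * ((-q ^ a) ^ (r + 1) * (q ^ 5) ^ c2 (r + 1) *
      partialTheta q (n - 2 + a + 5 * (r + 1))) :=
    ((Equiv.addRight (1 : ℤ)).summable_iff).2 (hs.mul_left (q ^ (n + 2)))
  rw [thetaSeries, lerchCoeff, lerchCoeff, ← tsum_mul_left,
    ← (Equiv.addRight (1 : ℤ)).tsum_eq (fun r : ℤ => q ^ (n + 2) * _)]
  simp only [Equiv.coe_addRight]
  rw [← (summable_gauss (pow_ne_zero 5 hq0) (norm_pow_lt_one hq1 (by norm_num)) hz).tsum_add hs']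
  refine tsum_congr fun r => ?_
  rw [c2_succ, partialTheta_eq hq0 hq1 (n + 4 - 2 + a + 5 * r),
    show n - 2 + a + 5 * (r + 1) = n + 4 - 2 + a + 5 * r + 1 by ring,
    zpow_add₀ (pow_ne_zero 5 hq0), zpow_add_one₀ hz, pow_natCast_zpow q 5 r,
    show n + 4 - 2 + a + 5 * r = (n + 2) + a + ((5 : ℕ) : ℤ) * r by push_cast; ring,
    zpow_add₀ hq0, zpow_add₀ hq0 (n + 2)]
  ring

/-- Apply `partialTheta_symm` to every term and substitute r ↦ 2 - r. -/
theorem lerchCoeff_symm {q : ℂ} (hq0 : q ≠ 0) (hq1 : ‖q‖ < 1) (a n : ℤ) :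
    lerchCoeff q a n = q ^ (a - 2 - n) * lerchCoeff q (-a) (-4 - n) := by
  rw [lerchCoeff, lerchCoeff, ← tsum_mul_left, ← (Equiv.subLeft (2 : ℤ)).tsum_eq]
  refine tsum_congr fun r => ?_
  rw [Equiv.subLeft_apply, partialTheta_symm hq0 hq1, neg_eq_neg_one_mul (q ^ a),
    neg_eq_neg_one_mul (q ^ (-a)), mul_zpow, mul_zpow, pow_natCast_zpow, pow_natCast_zpow,
    show 2 - (n - 2 + a + 5 * (2 - r)) = -4 - n - 2 + -a + 5 * r by ring,
    zpow_sub₀ (by norm_num : (-1 : ℂ) ≠ 0)]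
  have h1 : ((-1 : ℂ) ^ r)⁻¹ = (-1) ^ r := by rw [← inv_zpow]; norm_num
  have h2 : (q ^ a) ^ (2 - r) * q ^ (((5 : ℕ) : ℤ) * c2 (2 - r)) *
      q ^ (1 - (n - 2 + a + 5 * (2 - r))) =
      q ^ (a - 2 - n) * ((q ^ (-a)) ^ r * q ^ (((5 : ℕ) : ℤ) * c2 r)) := by
    have h3 := two_mul_c2 r
    have h4 := two_mul_c2 (2 - r)
    rw [← zpow_mul, ← zpow_mul, ← zpow_add₀ hq0, ← zpow_add₀ hq0, ← zpow_add₀ hq0,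
      ← zpow_add₀ hq0]
    congr 1
    push_cast
    linarith
  rw [div_eq_mul_inv, h1]
  linear_combination (-1) ^ r * partialTheta q (-4 - n - 2 + -a + 5 * r) * h2

/-- `∑_n (-x)^n q^{n(n-1)/2} lerchCoeff q a n` is a theta function times an Appell–Lerch sum. -/
theorem tsum_gauss_mul_lerchCoeff {q : ℂ} (hq0 : q ≠ 0) (hq1 : ‖q‖ < 1) {x : ℂ} (hx : x ≠ 0)
    (a : ℤ) (hne : ∀ r : ℤ, 1 - q ^ (a - 2 + 5 * r) / x ≠ 0) :
    (Summable fun n : ℤ => (-x) ^ n * q ^ c2 n * lerchCoeff q a n) ∧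
    ∑' n : ℤ, (-x) ^ n * q ^ c2 n * lerchCoeff q a n =
      thetaSeries x q * ∑' r : ℤ, appellLerchTerm (q ^ 3 / x) (q ^ 5) (q ^ a) r := by
  obtain ⟨C, hC⟩ := norm_partialTheta_le hq0 hq1
  obtain ⟨F, hF⟩ : ∃ F : ℤ → ℤ → ℂ, ∀ r n, F r n = (-q ^ a) ^ r * (q ^ 5) ^ c2 r *
      ((-x) ^ n * q ^ c2 n * partialTheta q (n + (a - 2 + 5 * r))) := ⟨_, fun _ _ => rfl⟩
  have hs : Summable (Function.uncurry F) :=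
    (summable_gauss_mul_gauss (pow_ne_zero 5 hq0) (norm_pow_lt_one hq1 (by norm_num))
      hq0 hq1 (neg_ne_zero.2 (zpow_ne_zero a hq0)) (neg_ne_zero.2 hx)
      (f := fun r n => partialTheta q (n + (a - 2 + 5 * r))) (fun r n => hC _)).congr
      fun p => (hF p.1 p.2).symm
  have e : ∀ n : ℤ, (-x) ^ n * q ^ c2 n * lerchCoeff q a n = ∑' r : ℤ, F r n := fun n => by
    rw [lerchCoeff, ← tsum_mul_left]
    refine tsum_congr fun r => ?_
    rw [hF, show n - 2 + a + 5 * r = n + (a - 2 + 5 * r) by ring]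
    ring
  refine ⟨?_, ?_⟩
  · exact (hs.prod_symm.prod).congr fun n => (e n).symm
  -- Summing over n first, `tsum_gauss_mul_partialTheta` restores the Appell–Lerch denominator of
  -- index r.
  · rw [tsum_congr e, hs.tsum_comm, ← tsum_mul_left]
    refine tsum_congr fun r => ?_
    have h1 : (q ^ 5) ^ (r - 1) * (q ^ 3 / x) * q ^ a = q ^ (a - 2 + 5 * r) / x := by
      rw [pow_natCast_zpow, show a - 2 + 5 * r = ((5 : ℕ) : ℤ) * (r - 1) + 3 + a by push_cast; ring,
        zpow_add₀ hq0, zpow_add₀ hq0]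
      norm_cast
      ring
    rw [tsum_congr (hF r), tsum_mul_left, tsum_gauss_mul_partialTheta hq0 hq1 hx (hne r),
      appellLerchTerm_eq, h1]
    ring

/-! ### Nonvanishing, convergence and symmetries of Appell–Lerch functions. -/

theorem one_sub_zpow_ne_zero {q : ℂ} (hq1 : ‖q‖ < 1) {k : ℤ} (hk : k ≠ 0) :
    1 - q ^ k ≠ 0 ∧ 1 + q ^ k ≠ 0 := by
  have h : ‖q ^ k‖ ≠ 1 := by
    rw [norm_zpow]
    intro h
    have := (zpow_eq_one_iff_right₀ (norm_nonneg q) hq1.ne).1 h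
    exact hk this
  refine ⟨fun h1 => h ?_, fun h1 => h ?_⟩
  · rw [← sub_eq_zero.1 h1, norm_one]
  · rw [eq_neg_of_add_eq_zero_right h1, norm_neg, norm_one]

theorem theta_ne_zero {q : ℂ} (hq1 : ‖q‖ < 1) {z : ℂ} (hz : z ≠ 0)
    (h : ∀ r : ℤ, 1 - q ^ r * z ≠ 0) : theta z q ≠ 0 := by
  refine mul_ne_zero (mul_ne_zero (qPochhammerInf_ne_zero hq1 fun i => ?_)
    (qPochhammerInf_ne_zero hq1 fun i h1 => ?_)) (qPochhammerInf_self_ne_zero hq1)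
  · exact_mod_cast h i
  · refine h (-(i + 1)) ?_
    rw [zpow_neg]
    have h2 : q ^ ((i : ℤ) + 1) = z := by
      norm_cast
      rw [pow_succ, ← div_eq_one_iff_eq hz, mul_div_assoc]
      exact (sub_eq_zero.1 h1).symm
    rw [h2, inv_mul_cancel₀ hz, sub_self]

/-- The values tend to 1 as r → ∞ and to 0 as r → -∞, and a vanishing denominator only contributes
0. -/
theorem norm_inv_one_sub_zpow_mul_le {q : ℂ} (hq0 : q ≠ 0) (hq1 : ‖q‖ < 1) {c : ℂ}
    (hc : c ≠ 0) : ∃ C : ℝ, ∀ r : ℤ, ‖(1 - q ^ r * c)⁻¹‖ ≤ C := by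
  have hp := tendsto_pow_atTop_nhds_zero_of_norm_lt_one hq1
  have h1 : Tendsto (fun n : ℕ => (1 - q ^ n * c)⁻¹) atTop (𝓝 (1 - 0 * c)⁻¹) :=
    ((hp.mul_const c).const_sub 1).inv₀ (by simp)
  have h2 : Tendsto (fun n : ℕ => q ^ n * (q ^ n - c)⁻¹) atTop (𝓝 (0 * (0 - c)⁻¹)) :=
    hp.mul ((hp.sub_const c).inv₀ (by simpa))
  obtain ⟨C1, hC1⟩ := h1.norm.bddAbove_range
  obtain ⟨C2, hC2⟩ := h2.norm.bddAbove_range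
  refine ⟨max C1 C2, fun r => ?_⟩
  rcases Int.eq_nat_or_neg r with ⟨n, rfl | rfl⟩
  · exact le_max_of_le_left (hC1 ⟨n, by simp⟩)
  · refine le_max_of_le_right (hC2 ⟨n, ?_⟩)
    have hq := pow_ne_zero n hq0
    simp only [zpow_neg, zpow_natCast]
    rw [show 1 - (q ^ n)⁻¹ * c = (q ^ n)⁻¹ * (q ^ n - c) by field_simp, mul_inv, inv_inv]

theorem summable_appellLerchTerm {q : ℂ} (hq0 : q ≠ 0) (hq1 : ‖q‖ < 1) {x z : ℂ}
    (hx : x ≠ 0) (hz : z ≠ 0) : Summable (appellLerchTerm x q z) := by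
  obtain ⟨C, hC⟩ := norm_inv_one_sub_zpow_mul_le hq0 hq1 (mul_ne_zero hx hz)
  refine (summable_gauss_mul_bounded hq0 hq1 (neg_ne_zero.2 hz)
    (f := fun r => (1 - q ^ (r - 1) * (x * z))⁻¹) fun r => hC _).congr fun r => ?_
  rw [appellLerchTerm_eq, mul_assoc (q ^ (r - 1)), div_eq_mul_inv]

theorem appellLerchDefined_of_ne {q : ℂ} (hq0 : q ≠ 0) (hq1 : ‖q‖ < 1) {x z : ℂ}
    (hx : x ≠ 0) (hz : z ≠ 0) (h1 : ∀ r : ℤ, 1 - q ^ r * z ≠ 0)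
    (h2 : ∀ r : ℤ, 1 - q ^ (r - 1) * x * z ≠ 0) : AppellLerchDefined x q z :=
  ⟨theta_ne_zero hq1 hz h1, h2, summable_appellLerchTerm hq0 hq1 hx hz⟩

theorem appellLerch_eq {q : ℂ} (hq0 : q ≠ 0) (hq1 : ‖q‖ < 1) (x : ℂ) {z : ℂ} (hz : z ≠ 0) :
    appellLerch x q z = (thetaSeries z q)⁻¹ * ∑' r : ℤ, appellLerchTerm x q z r := by
  rw [appellLerch, theta_eq_thetaSeries hq0 hq1 hz, one_div]

/-- The substitution r ↦ 2 - r matches the two series term by term up to the factor -x/z, and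
`thetaSeries_inv` accounts for the rest. -/
theorem appellLerch_inv {q : ℂ} (hq0 : q ≠ 0) (hq1 : ‖q‖ < 1) {x z : ℂ} (hx : x ≠ 0)
    (hz : z ≠ 0) : appellLerch x⁻¹ q z⁻¹ = x * appellLerch x q z := by
  have h : ∑' r : ℤ, appellLerchTerm x⁻¹ q z⁻¹ r =
      -(x / z) * ∑' r : ℤ, appellLerchTerm x q z r := by
    rw [← (Equiv.subLeft (2 : ℤ)).tsum_eq, ← tsum_mul_left]
    refine tsum_congr fun r => ?_
    have hz' := neg_ne_zero.2 hz
    have h1 : c2 (2 - r) = c2 r + 1 - r := by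
      have h3 := two_mul_c2 r
      have h4 := two_mul_c2 (2 - r)
      linarith
    have hy : q ^ (r - 1) * x * z ≠ 0 := mul_ne_zero (mul_ne_zero (zpow_ne_zero _ hq0) hx) hz
    have h2 : q ^ (2 - r - 1) * x⁻¹ * z⁻¹ = (q ^ (r - 1) * x * z)⁻¹ := by
      rw [mul_inv, mul_inv, ← zpow_neg]
      congr 3
      ring
    have h5 : q ^ (c2 r + 1 - r) = q ^ c2 r * (q ^ (r - 1))⁻¹ := by
      rw [← zpow_neg, ← zpow_add₀ hq0]; congr 1; ring
    have h6 : (-z⁻¹) ^ (2 - r) = (-z) ^ r * (z ^ 2)⁻¹ := by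
      rw [← inv_neg, inv_zpow', zpow_neg, ← zpow_neg, neg_sub, zpow_sub₀ hz', div_eq_mul_inv]
      norm_num
    rw [Equiv.subLeft_apply, appellLerchTerm_eq, appellLerchTerm_eq, h1, h2, h5, h6]
    have hr := zpow_ne_zero (r - 1) hq0
    generalize q ^ (r - 1) = u at *
    -- If one denominator vanishes then so does the other, and both terms are 0 by convention; hence
    -- poles need not be excluded.
    by_cases h7 : u * x * z = 1
    · rw [h7]; simp
    · have h8 : 1 - u * x * z ≠ 0 := sub_ne_zero.2 (Ne.symm h7)
      have h9 : 1 - (u * x * z)⁻¹ ≠ 0 := by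
        rw [sub_ne_zero]; exact fun h => h7 (by rw [← inv_inv (u * x * z), ← h, inv_one])
      have h10 : u * x * z - 1 ≠ 0 := sub_ne_zero.2 h7
      rw [show 1 - (u * x * z)⁻¹ = -(1 - u * x * z) / (u * x * z) by field_simp; ring]
      field_simp
  rw [appellLerch_eq hq0 hq1 _ hz, appellLerch_eq hq0 hq1 _ (inv_ne_zero hz), h,
    thetaSeries_inv hq0 hz, mul_inv, inv_neg, inv_inv]
  field_simp

/-- The shift r ↦ r + 1 gives the series the factor -1/z, which the theta function in front also
acquires. -/
theorem appellLerch_mul_left {q : ℂ} (hq0 : q ≠ 0) (hq1 : ‖q‖ < 1) (x : ℂ) {z : ℂ}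
    (hz : z ≠ 0) : appellLerch x q (q * z) = appellLerch x q z := by
  have hz' := neg_ne_zero.2 hz
  have h : ∑' r : ℤ, appellLerchTerm x q (q * z) r =
      -z⁻¹ * ∑' r : ℤ, appellLerchTerm x q z r := by
    rw [← (Equiv.addRight (1 : ℤ)).tsum_eq (appellLerchTerm x q z), ← tsum_mul_left]
    refine tsum_congr fun r => ?_
    rw [Equiv.coe_addRight, appellLerchTerm_eq, appellLerchTerm_eq, c2_succ, add_sub_cancel_right,
      zpow_add₀ hq0, zpow_add_one₀ hz', neg_mul_eq_mul_neg, mul_zpow,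
      show q ^ (r - 1) * x * (q * z) = q ^ r * x * z by rw [zpow_sub_one₀ hq0]; field_simp]
    field_simp
  rw [appellLerch_eq hq0 hq1 _ hz, appellLerch_eq hq0 hq1 _ (mul_ne_zero hq0 hz), h,
    thetaSeries_mul_left hq0 hz, mul_inv, ← mul_assoc, mul_right_comm _ _ (-z⁻¹),
    inv_mul_cancel₀ (neg_ne_zero.2 (inv_ne_zero hz)), one_mul]

theorem thetaSeries_inv_mul_tsum_appellLerchTerm {q : ℂ} (hq0 : q ≠ 0) (hq1 : ‖q‖ < 1) {u z : ℂ}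
    (hu : u ≠ 0) (hz : z ≠ 0) (h : ∀ r : ℤ, 1 - q ^ (r - 1) * u ≠ 0) :
    thetaSeries u⁻¹ q * ∑' r : ℤ, appellLerchTerm (u / z) q z r =
      ∑' r : ℤ, ∑' n : ℤ, (-z) ^ r * q ^ c2 r *
        ((-u⁻¹) ^ n * q ^ c2 n * partialTheta q (r + n - 1)) := by
  rw [← tsum_mul_left]
  refine tsum_congr fun r => ?_
  have h1 : 1 - q ^ (r - 1) / u⁻¹ ≠ 0 := by rw [div_inv_eq_mul]; exact h r
  have h2 := tsum_gauss_mul_partialTheta hq0 hq1 (inv_ne_zero hu) h1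
  rw [tsum_mul_left, appellLerchTerm_eq, mul_assoc (q ^ (r - 1)), div_mul_cancel₀ _ hz]
  rw [div_inv_eq_mul] at h2
  simp only [show ∀ n : ℤ, r + n - 1 = n + (r - 1) from fun n => by ring]
  rw [h2]
  ring

/-- Since x z = 1/w, expanding j(w)/(1 - q^{r-1}/w) in partial theta functions turns j(w) j(z) m(x,
q, z) into a double sum symmetric in z and w. -/
theorem appellLerch_flip {q : ℂ} (hq0 : q ≠ 0) (hq1 : ‖q‖ < 1) {x z w : ℂ}
    (hz : z ≠ 0) (hw : x * z * w = 1) (h1 : ∀ r : ℤ, 1 - q ^ r * z ≠ 0)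
    (h2 : ∀ r : ℤ, 1 - q ^ r * w ≠ 0) :
    appellLerch x q z = appellLerch x q w := by
  have hw0 : w ≠ 0 := right_ne_zero_of_mul_eq_one hw
  have aux : ∀ {y : ℂ}, y ≠ 0 → (∀ r : ℤ, 1 - q ^ r * y ≠ 0) →
      ∀ r : ℤ, 1 - q ^ (r - 1) * y⁻¹ ≠ 0 := fun {y} hy hr r h0 => by
    refine hr (-(r - 1)) ?_
    rw [sub_eq_zero, eq_comm, mul_inv_eq_one₀ hy] at h0
    rw [zpow_neg, h0, inv_mul_cancel₀ hy, sub_self]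
  obtain ⟨C, hC⟩ := norm_partialTheta_le hq0 hq1
  obtain ⟨F, hF⟩ : ∃ F : ℤ → ℤ → ℂ, ∀ r n, F r n = (-z) ^ r * q ^ c2 r *
      ((-w) ^ n * q ^ c2 n * partialTheta q (r + n - 1)) := ⟨_, fun _ _ => rfl⟩
  have hs : Summable (Function.uncurry F) :=
    (summable_gauss_mul_gauss hq0 hq1 hq0 hq1 (neg_ne_zero.2 hz) (neg_ne_zero.2 hw0)
      (f := fun r n => partialTheta q (r + n - 1)) (fun r n => hC _)).congr
      fun p => (hF p.1 p.2).symm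
  have e1 := thetaSeries_inv_mul_tsum_appellLerchTerm hq0 hq1 (inv_ne_zero hw0) hz (aux hw0 h2)
  have e2 := thetaSeries_inv_mul_tsum_appellLerchTerm hq0 hq1 (inv_ne_zero hz) hw0 (aux hz h1)
  have x1 : w⁻¹ / z = x := by field_simp; linear_combination -hw
  have x2 : z⁻¹ / w = x := by field_simp; linear_combination -hw
  rw [inv_inv, x1] at e1
  rw [inv_inv, x2] at e2
  have e3 : thetaSeries w q * ∑' r : ℤ, appellLerchTerm x q z r =
      thetaSeries z q * ∑' r : ℤ, appellLerchTerm x q w r := by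
    rw [e1, e2, ← tsum_congr fun r => tsum_congr (hF r), ← hs.tsum_comm]
    refine tsum_congr fun n => tsum_congr fun r => ?_
    rw [hF, add_comm r n]
    ring
  have t1 := theta_ne_zero hq1 hz h1
  have t2 := theta_ne_zero hq1 hw0 h2
  rw [theta_eq_thetaSeries hq0 hq1 hz] at t1
  rw [theta_eq_thetaSeries hq0 hq1 hw0] at t2
  rw [appellLerch_eq hq0 hq1 _ hz, appellLerch_eq hq0 hq1 _ hw0, inv_mul_eq_div, inv_mul_eq_div,
    div_eq_div_iff t1 t2]
  linear_combination e3

/-! ### The Hecke-type double sum and its Appell–Lerch evaluations. -/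

theorem hasSum_of_forall_eq {α : Type*} {f g : α → ℂ} {A : ℂ} (h : HasSum f A)
    (e : ∀ n, f n = g n) : HasSum g A :=
  (funext e : f = g) ▸ h

/-- The sequence `∑_{0 ≤ i < n} q^{i(n-1-i)}`, which carries the coefficients of the double sums
for the tenth-order mock theta functions. -/
def heckeCoeff (q : ℂ) : ℕ → ℂ
  | 0 => 0
  | 1 => 1
  | n + 2 => 2 + q ^ n * heckeCoeff q n

/-- Antisymmetry supplies both initial values of the two-step recursion: t(0) = -t(0), and the
recursion at -1 reads t(1) = 2 - t(1). -/
theorem eq_heckeCoeff {q : ℂ} (hq0 : q ≠ 0) {t : ℤ → ℂ}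
    (h1 : ∀ n, t (n + 2) = 2 + q ^ n * t n) (h2 : ∀ n, t (-n) = -q ^ n * t n) :
    ∀ n : ℕ, t n = heckeCoeff q n
  | 0 => by
    have := h2 0
    simp only [neg_zero, zpow_zero, neg_mul, one_mul] at this
    simpa [heckeCoeff] using self_eq_neg.1 this
  | 1 => by
    have h3 := h1 (-1)
    rw [h2 1, zpow_neg_one, zpow_one] at h3
    norm_num at h3
    rw [← mul_assoc, inv_mul_cancel₀ hq0, one_mul] at h3
    rw [heckeCoeff, Nat.cast_one]
    linear_combination h3 / 2
  | n + 2 => by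
    rw [heckeCoeff, ← eq_heckeCoeff hq0 h1 h2 n, Nat.cast_add, Nat.cast_two, h1, zpow_natCast]

/-- The Hecke-type double sum `f_{2,3,2}(x, x, q)`, with the inner sums carried out. -/
def heckeSum (x q : ℂ) : ℂ :=
  ∑' n : ℕ, ((-x) ^ n * q ^ (2 * c2 n) - (-x) ^ (-(n : ℤ) - 2) * q ^ (2 * c2 n + 7 * n + 7)) *
    heckeCoeff q (n + 1)

/-- Folding of a bilateral sum with antisymmetric coefficients. -/
theorem heckeSum_eq_of_hasSum {q : ℂ} (hq0 : q ≠ 0) {x A : ℂ} {t : ℤ → ℂ}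
    (h1 : ∀ n, t (n + 2) = 2 + q ^ n * t n) (h2 : ∀ n, t (-n) = -q ^ n * t n)
    (hA : HasSum (fun n => (-x) ^ (n - 1) * q ^ (2 * c2 (n - 1)) * t n) A) :
    heckeSum x q = A := by
  have hs := hA.summable
  have hs1 : Summable fun n : ℕ => (-x) ^ ((n : ℤ) + 1 - 1) * q ^ (2 * c2 ((n : ℤ) + 1 - 1)) *
      t ((n : ℤ) + 1) :=
    hs.comp_injective (i := fun n : ℕ => (n : ℤ) + 1) fun a b hab => by simpa using hab
  have hs2 : Summable fun n : ℕ => (-x) ^ (-((n : ℤ) + 1) - 1) *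
      q ^ (2 * c2 (-((n : ℤ) + 1) - 1)) * t (-((n : ℤ) + 1)) :=
    hs.comp_injective (i := fun n : ℕ => -((n : ℤ) + 1)) fun a b hab => by simpa using hab
  have h0 : t 0 = 0 := by simpa [heckeCoeff] using eq_heckeCoeff hq0 h1 h2 0
  have h3 := tsum_of_add_one_of_neg_add_one
    (f := fun n => (-x) ^ (n - 1) * q ^ (2 * c2 (n - 1)) * t n) hs1 hs2
  rw [hA.tsum_eq, h0, mul_zero, add_zero, ← hs1.tsum_add hs2] at h3
  rw [h3, heckeSum]
  refine tsum_congr fun n => ?_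
  -- The term of index -(n+1) is folded onto that of index n + 1; antisymmetry contributes the sign
  -- and the factor q^{n+1}.
  have h4 : q ^ (2 * c2 n + 7 * n + 7) = q ^ (2 * c2 (-((n : ℤ) + 1) - 1)) * q ^ ((n : ℤ) + 1) := by
    rw [← zpow_add₀ hq0]
    have h5 := two_mul_c2 n
    have h6 := two_mul_c2 (-((n : ℤ) + 1) - 1)
    congr 1
    linarith
  rw [h2, ← eq_heckeCoeff hq0 h1 h2 (n + 1), Nat.cast_succ, add_sub_cancel_right, h4,
    zpow_natCast, show -((n : ℤ) + 1) - 1 = -n - 2 by ring]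
  ring

/-- The symmetrised and normalised coefficients `lerchCoeff`. -/
def lerchPairCoeff (q : ℂ) (a n : ℤ) : ℂ :=
  lerchCoeff q a n / thetaSeries (q ^ a) (q ^ 5) +
    lerchCoeff q (-a) n / thetaSeries (q ^ (-a)) (q ^ 5)

theorem thetaSeries_zpow_ne_zero {q : ℂ} (hq0 : q ≠ 0) (hq1 : ‖q‖ < 1) {a : ℤ}
    (ha : ¬ 5 ∣ a) : thetaSeries (q ^ a) (q ^ 5) ≠ 0 := by
  have h5 := norm_pow_lt_one hq1 (k := 5) (by norm_num)
  rw [← theta_eq_thetaSeries (pow_ne_zero 5 hq0) h5 (zpow_ne_zero _ hq0)]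
  refine theta_ne_zero h5 (zpow_ne_zero _ hq0) fun r => ?_
  rw [pow_natCast_zpow, ← zpow_add₀ hq0]
  refine (one_sub_zpow_ne_zero hq1 ?_).1
  push_cast
  omega

/-- After division by the theta values, each of a and -a contributes the constant 1. -/
theorem lerchPairCoeff_add_four {q : ℂ} (hq0 : q ≠ 0) (hq1 : ‖q‖ < 1) {a : ℤ} (ha : ¬ 5 ∣ a)
    (n : ℤ) : lerchPairCoeff q a (n + 4) = 2 + q ^ (n + 2) * lerchPairCoeff q a n := by
  have t1 := thetaSeries_zpow_ne_zero hq0 hq1 ha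
  have t2 := thetaSeries_zpow_ne_zero hq0 hq1 (a := -a) (by omega)
  rw [lerchPairCoeff, lerchPairCoeff, lerchCoeff_add_four hq0 hq1, lerchCoeff_add_four hq0 hq1]
  field_simp
  ring

/-- Reflection exchanges the summands for a and -a; the sign comes from j(q^{-a}; q⁵) = -q^{-a}
j(q^a; q⁵). -/
theorem lerchPairCoeff_neg {q : ℂ} (hq0 : q ≠ 0) (hq1 : ‖q‖ < 1) {a : ℤ} (ha : ¬ 5 ∣ a)
    (n : ℤ) : lerchPairCoeff q a (-4 - n) = -q ^ (n + 2) * lerchPairCoeff q a n := by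
  have t1 := thetaSeries_zpow_ne_zero hq0 hq1 ha
  have t2 := thetaSeries_zpow_ne_zero hq0 hq1 (a := -a) (by omega)
  have hqa := zpow_ne_zero a hq0
  have h3 : thetaSeries (q ^ (-a)) (q ^ 5) = -(q ^ a)⁻¹ * thetaSeries (q ^ a) (q ^ 5) := by
    rw [zpow_neg, thetaSeries_inv (pow_ne_zero 5 hq0) hqa]
  rw [lerchPairCoeff, lerchPairCoeff, lerchCoeff_symm hq0 hq1 a (-4 - n),
    lerchCoeff_symm hq0 hq1 (-a) (-4 - n), neg_neg, h3,
    show -4 - (-4 - n) = n by ring, show a - 2 - (-4 - n) = a + (n + 2) by ring,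
    show -a - 2 - (-4 - n) = -a + (n + 2) by ring, zpow_add₀ hq0 a, zpow_add₀ hq0 (-a), zpow_neg]
  field_simp
  ring

/-- The generating function of `lerchPairCoeff` in terms of Appell–Lerch functions. -/
theorem tsum_gauss_mul_lerchPairCoeff {q : ℂ} (hq0 : q ≠ 0) (hq1 : ‖q‖ < 1) {x : ℂ} (hx : x ≠ 0)
    (a : ℤ) (hne : ∀ r : ℤ, 1 - q ^ (a - 2 + 5 * r) / x ≠ 0)
    (hne' : ∀ r : ℤ, 1 - q ^ (-a - 2 + 5 * r) / x ≠ 0) :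
    (Summable fun n : ℤ => (-x) ^ n * q ^ c2 n * lerchPairCoeff q a n) ∧
    ∑' n : ℤ, (-x) ^ n * q ^ c2 n * lerchPairCoeff q a n =
      thetaSeries x q * (appellLerch (q ^ 3 / x) (q ^ 5) (q ^ a) +
        appellLerch (q ^ 3 / x) (q ^ 5) (q ^ (-a))) := by
  have h5 := norm_pow_lt_one hq1 (k := 5) (by norm_num)
  have h50 := pow_ne_zero 5 hq0
  obtain ⟨s1, e1⟩ := tsum_gauss_mul_lerchCoeff hq0 hq1 hx a hne
  obtain ⟨s2, e2⟩ := tsum_gauss_mul_lerchCoeff hq0 hq1 hx (-a) hne'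
  have h := (s1.div_const (thetaSeries (q ^ a) (q ^ 5))).hasSum.add
    (s2.div_const (thetaSeries (q ^ (-a)) (q ^ 5))).hasSum
  rw [tsum_div_const, tsum_div_const, e1, e2] at h
  have h' : HasSum (fun n : ℤ => (-x) ^ n * q ^ c2 n * lerchPairCoeff q a n) _ :=
    hasSum_of_forall_eq h fun n => by rw [lerchPairCoeff]; ring
  refine ⟨h'.summable, h'.tsum_eq.trans ?_⟩
  rw [appellLerch_eq h50 h5 _ (zpow_ne_zero _ hq0), appellLerch_eq h50 h5 _ (zpow_ne_zero _ hq0)]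
  ring

/-- A decomposition of `f_{2,3,2}(x, x, q)` into Appell–Lerch functions of base `q¹⁰`. -/
theorem heckeSum_eq_add {q : ℂ} (hq0 : q ≠ 0) (hq1 : ‖q‖ < 1) {x : ℂ} (hx : x ≠ 0) {a : ℤ}
    (ha : ¬ 5 ∣ a) (h1 : ∀ r : ℤ, 1 - (q ^ 2) ^ (a - 2 + 5 * r) / x ≠ 0)
    (h2 : ∀ r : ℤ, 1 - (q ^ 2) ^ (-a - 2 + 5 * r) / x ≠ 0)
    (h3 : ∀ r : ℤ, 1 - (q ^ 2) ^ (a - 2 + 5 * r) / (q ^ 5 * x) ≠ 0)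
    (h4 : ∀ r : ℤ, 1 - (q ^ 2) ^ (-a - 2 + 5 * r) / (q ^ 5 * x) ≠ 0) :
    heckeSum x q =
      thetaSeries x (q ^ 2) * (appellLerch ((q ^ 2) ^ 3 / x) ((q ^ 2) ^ 5) ((q ^ 2) ^ a) +
        appellLerch ((q ^ 2) ^ 3 / x) ((q ^ 2) ^ 5) ((q ^ 2) ^ (-a))) +
      q ^ 3 * x ^ 2 * (thetaSeries (q ^ 5 * x) (q ^ 2) *
        (appellLerch ((q ^ 2) ^ 3 / (q ^ 5 * x)) ((q ^ 2) ^ 5) ((q ^ 2) ^ a) +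
        appellLerch ((q ^ 2) ^ 3 / (q ^ 5 * x)) ((q ^ 2) ^ 5) ((q ^ 2) ^ (-a)))) := by
  have hb0 := pow_ne_zero 2 hq0
  have hb1 := norm_pow_lt_one hq1 (k := 2) (by norm_num)
  have hx' := neg_ne_zero.2 hx
  have k1 := tsum_gauss_mul_lerchPairCoeff hb0 hb1 hx a h1 h2
  have k2 := tsum_gauss_mul_lerchPairCoeff hb0 hb1 (mul_ne_zero (pow_ne_zero 5 hq0) hx) a h3 h4
  set τ : ℤ → ℂ := lerchPairCoeff (q ^ 2) a with hτ
  have s1 := k1.1.hasSum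
  have s2 := k2.1.hasSum.mul_left (q ^ 3 * x ^ 2)
  rw [k1.2, ← (Equiv.subRight (1 : ℤ)).hasSum_iff] at s1
  rw [k2.2, ← (Equiv.subRight (3 : ℤ)).hasSum_iff] at s2
  have p4 : ∀ n, τ (n + 4) = 2 + q ^ (2 * n + 4) * τ n := fun n => by
    rw [hτ, lerchPairCoeff_add_four hb0 hb1 ha, pow_natCast_zpow]
    congr 3
    push_cast
    ring
  have pn : ∀ n, τ (-4 - n) = -q ^ (2 * n + 4) * τ n := fun n => by
    rw [hτ, lerchPairCoeff_neg hb0 hb1 ha, pow_natCast_zpow]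
    congr 3
    push_cast
    ring
  -- In t(n+2) the term τ(n+1) = τ((n-3)+4) is expanded by the four-step recursion; its factor
  -- q^{2n-2} = q^n q^{n-2} reproduces the second summand of q^n t(n).
  refine heckeSum_eq_of_hasSum hq0 (t := fun n => τ (n - 1) + q ^ (n - 2) * τ (n - 3))
    (fun n => ?_) (fun n => ?_) (hasSum_of_forall_eq (s1.add s2) fun n => ?_)
  · rw [show n + 2 - 1 = n - 3 + 4 by ring, p4, show n + 2 - 3 = n - 1 by ring,
      show n + 2 - 2 = n by ring, show 2 * (n - 3) + 4 = n + (n - 2) by ring, zpow_add₀ hq0]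
    ring
  · have e1 : q ^ (-n - 2) * q ^ (2 * (n - 1) + 4) = q ^ n := by
      rw [← zpow_add₀ hq0]; congr 1; ring
    have e2 : q ^ (2 * (n - 3) + 4) = q ^ n * q ^ (n - 2) := by
      rw [← zpow_add₀ hq0]; congr 1; ring
    rw [show -n - 1 = -4 - (n - 3) by ring, pn, show -n - 3 = -4 - (n - 1) by ring, pn, e2]
    linear_combination -τ (n - 1) * e1
  · simp only [Function.comp, Equiv.subRight_apply]
    have e1 : (-x) ^ (n - 1) = (-x) ^ (n - 3) * x ^ 2 := by
      rw [show n - 1 = n - 3 + 2 by ring, zpow_add₀ hx']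
      norm_cast
      rw [neg_sq]
    have e2 : q ^ (2 * c2 (n - 1)) * q ^ (n - 2) =
        q ^ 3 * (q ^ (5 * (n - 3)) * q ^ (2 * c2 (n - 3))) := by
      rw [← zpow_natCast q 3, ← zpow_add₀ hq0, ← zpow_add₀ hq0, ← zpow_add₀ hq0]
      have h5 := two_mul_c2 (n - 1)
      have h6 := two_mul_c2 (n - 3)
      congr 1
      push_cast
      linarith
    have e3 : (-(q ^ 5 * x)) ^ (n - 3) = q ^ (5 * (n - 3)) * (-x) ^ (n - 3) := by
      rw [neg_mul_eq_mul_neg, mul_zpow, pow_natCast_zpow, Nat.cast_ofNat]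
    rw [pow_natCast_zpow, pow_natCast_zpow, e3, Nat.cast_ofNat, mul_add]
    congr 1
    rw [e1]
    linear_combination -(-x) ^ (n - 3) * x ^ 2 * τ (n - 3) * e2

/-- An evaluation of `f_{2,3,2}(x, x, q²)` by Appell–Lerch functions of base `q⁵`. -/
theorem heckeSum_sq_eq {q : ℂ} (hq0 : q ≠ 0) (hq1 : ‖q‖ < 1) {y : ℂ} (hy : y ≠ 0) {a : ℤ}
    (ha : ¬ 5 ∣ a) (hθ : thetaSeries y q = 0)
    (h1 : ∀ r : ℤ, 1 - q ^ (a - 2 + 5 * r) / y ≠ 0)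
    (h2 : ∀ r : ℤ, 1 - q ^ (-a - 2 + 5 * r) / y ≠ 0)
    (h3 : ∀ r : ℤ, 1 - q ^ (a - 2 + 5 * r) / (-y) ≠ 0)
    (h4 : ∀ r : ℤ, 1 - q ^ (-a - 2 + 5 * r) / (-y) ≠ 0) :
    2 * heckeSum (-(q * y ^ 2)) (q ^ 2) =
      thetaSeries (-y) q * (appellLerch (q ^ 3 / (-y)) (q ^ 5) (q ^ a) +
        appellLerch (q ^ 3 / (-y)) (q ^ 5) (q ^ (-a))) := by
  have hb0 := pow_ne_zero 2 hq0
  have k1 := tsum_gauss_mul_lerchPairCoeff hq0 hq1 hy a h1 h2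
  have k2 := tsum_gauss_mul_lerchPairCoeff hq0 hq1 (neg_ne_zero.2 hy) a h3 h4
  set τ : ℤ → ℂ := lerchPairCoeff q a with hτ
  -- Averaging the expansions at y and -y keeps the even powers only, while j(y; q) = 0 removes one
  -- Appell–Lerch block.
  have s := (k1.1.hasSum.add k2.1.hasSum).div_const 2
  have hinj : Function.Injective fun n : ℤ => 2 * (n - 1) := fun a b hab => by
    simpa using hab
  rw [k1.2, k2.2, hθ, zero_mul, zero_add, neg_neg, ← hinj.hasSum_iff] at s
  · rw [heckeSum_eq_of_hasSum hb0 (t := fun n => τ (2 * (n - 1)))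
      (fun n => ?_) (fun n => ?_) (hasSum_of_forall_eq s fun n => ?_)]
    · ring
    · rw [show 2 * (n + 2 - 1) = 2 * (n - 1) + 4 by ring, hτ, lerchPairCoeff_add_four hq0 hq1 ha,
        pow_natCast_zpow]
      congr 3
      push_cast
      ring
    · rw [show 2 * (-n - 1) = -4 - 2 * (n - 1) by ring, hτ, lerchPairCoeff_neg hq0 hq1 ha,
        pow_natCast_zpow]
      congr 3
      push_cast
      ring
    · simp only [Function.comp]
      have e1 : (-y) ^ (2 * (n - 1)) = y ^ (2 * (n - 1)) := by
        rw [zpow_mul, zpow_mul]; norm_cast; rw [neg_sq]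
      have e2 : q ^ c2 (2 * (n - 1)) = q ^ (n - 1) * q ^ (2 * (2 * c2 (n - 1))) := by
        rw [← zpow_add₀ hq0]
        have h5 := two_mul_c2 (n - 1)
        have h6 := two_mul_c2 (2 * (n - 1))
        congr 1
        linarith
      rw [e1, e2, neg_neg, mul_zpow, pow_natCast_zpow, pow_natCast_zpow, Nat.cast_ofNat]
      ring
  · intro n hn
    have hodd : Odd n := by
      rw [← Int.not_even_iff_odd]
      rintro ⟨m, rfl⟩
      exact hn ⟨m + 1, by ring⟩
    rw [hodd.neg_zpow]
    ring

/-! ### The ₁φ₁ summation and Bailey's lemma. -/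

theorem exists_norm_phiOne_le {q : ℂ} (hq1 : ‖q‖ < 1) (A : ℂ) :
    ∃ C : ℝ, 0 ≤ C ∧ ∀ (k : ℕ) (m n : ℤ),
      ‖qPochhammer A q k * (invPoch q m * invPoch q n)‖ ≤ C := by
  obtain ⟨C, hC0, hC⟩ := norm_invPoch_le hq1
  obtain ⟨D, hD⟩ := norm_qPochhammer_le hq1 A
  have hD0 : 0 ≤ D := (norm_nonneg _).trans (hD 0)
  refine ⟨D * (C * C), by positivity, fun k m n => ?_⟩
  rw [norm_mul, norm_mul]
  exact mul_le_mul (hD k) (mul_le_mul (hC _) (hC _) (norm_nonneg _) hC0) (by positivity) hD0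

theorem summable_gauss_nat_mul_bounded {q : ℂ} (hq1 : ‖q‖ < 1) (x : ℂ) {f : ℕ → ℂ} {C : ℝ}
    (hf : ∀ n, ‖f n‖ ≤ C) : Summable fun n : ℕ => x ^ n * q ^ n.choose 2 * f n := by
  refine Summable.of_norm_bounded ((summable_gauss_nat hq1 x).norm.mul_right C) fun n => ?_
  rw [norm_mul]
  gcongr
  exact hf n

/-- The summand of the `₁φ₁` series with upper parameter `A` and lower parameter `q^{m+1}`. -/
def phiOneTerm (q A T : ℂ) (m : ℤ) (k : ℕ) : ℂ :=
  (-T) ^ k * q ^ k.choose 2 * (qPochhammer A q k * (invPoch q k * invPoch q (m + k)))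

theorem summable_phiOneTerm {q : ℂ} (hq1 : ‖q‖ < 1) (A T : ℂ) (m : ℤ) :
    Summable (phiOneTerm q A T m) := by
  obtain ⟨C, -, hC⟩ := exists_norm_phiOne_le hq1 A
  exact summable_gauss_nat_mul_bounded hq1 (-T) fun k => hC k _ _

/-- The difference of the two summands telescopes. The telescoping sequence contains `invPoch q (k -
1)`, which vanishes at k = 0, so no boundary term remains. -/
theorem tsum_phiOneTerm_succ {q : ℂ} (hq0 : q ≠ 0) (hq1 : ‖q‖ < 1) {A T : ℂ} {m : ℤ}
    (h : A * T = q ^ (m + 1)) :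
    ∑' k, phiOneTerm q A T m k = (1 - T) * ∑' k, phiOneTerm q A (q * T) (m + 1) k := by
  obtain ⟨C, -, hC⟩ := exists_norm_phiOne_le hq1 A
  have hG : Summable fun k : ℕ => (-T) ^ k * q ^ k.choose 2 *
      (qPochhammer A q k * (invPoch q (k - 1) * invPoch q (m + k))) :=
    summable_gauss_nat_mul_bounded hq1 (-T) fun k => hC k _ _
  have hG0 := hG.tsum_eq_zero_add
  rw [Nat.cast_zero, zero_sub, invPoch_of_neg q (by norm_num), zero_mul, mul_zero, mul_zero,
    zero_add] at hG0
  have e : ∀ k : ℕ, phiOneTerm q A T m k - (1 - T) * phiOneTerm q A (q * T) (m + 1) k =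
      (-T) ^ k * q ^ k.choose 2 *
        (qPochhammer A q k * (invPoch q (k - 1) * invPoch q (m + k))) -
      (-T) ^ (k + 1) * q ^ (k + 1).choose 2 * (qPochhammer A q (k + 1) *
        (invPoch q ((k + 1 : ℕ) - 1) * invPoch q (m + (k + 1 : ℕ)))) := fun k => by
    have h1 : q ^ (m + k + 1) = A * T * q ^ k := by
      rw [h, add_right_comm, zpow_add₀ hq0, zpow_natCast]
    rw [phiOneTerm, phiOneTerm, choose_succ_two, qPochhammer_succ, invPoch_sub_one hq1 k,
      Nat.cast_succ, add_sub_cancel_right, ← add_assoc m, add_right_comm m 1,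
      invPoch_eq hq1 (m + k), h1, zpow_natCast, pow_add q, pow_succ (-T),
      neg_mul_eq_mul_neg q, mul_pow]
    ring
  have h2 := ((summable_phiOneTerm hq1 A T m).hasSum.sub
    ((summable_phiOneTerm hq1 A (q * T) (m + 1)).hasSum.mul_left (1 - T)))
  have h3 := (hG.hasSum.sub ((summable_nat_add_iff 1).2 hG).hasSum)
  have h4 := h2.unique (hasSum_of_forall_eq h3 fun k => (e k).symm)
  rw [← hG0, sub_self] at h4
  exact sub_eq_zero.1 h4

/-- The `₁φ₁` summation. -/
theorem tsum_phiOneTerm {q : ℂ} (hq0 : q ≠ 0) (hq1 : ‖q‖ < 1) {A T : ℂ} {m : ℤ}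
    (h : A * T = q ^ (m + 1)) :
    ∑' k, phiOneTerm q A T m k = qPochhammerInf T q * (qPochhammerInf q q)⁻¹ := by
  have iter : ∀ n : ℕ, ∑' k, phiOneTerm q A T m k =
      qPochhammer T q n * ∑' k, phiOneTerm q A (q ^ n * T) (m + n) k := fun n => by
    induction n with
    | zero => simp [qPochhammer_zero]
    | succ n ih =>
      rw [ih, tsum_phiOneTerm_succ hq0 hq1 (A := A) (T := q ^ n * T) (m := m + n),
        qPochhammer_succ, pow_succ', Nat.cast_succ, mul_assoc q, add_assoc m, mul_assoc]
      rw [mul_left_comm, h, add_right_comm, zpow_add₀ hq0 (m + 1), zpow_natCast, mul_comm]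
  obtain ⟨C, hC0, hC⟩ := exists_norm_phiOne_le hq1 A
  have hcast : Tendsto (fun N : ℕ => (N : ℤ)) atTop atTop := tendsto_natCast_atTop_atTop
  -- Under iteration T is replaced by q^n T → 0, so only the term k = 0 survives in the limit.
  have lim : Tendsto (fun n : ℕ => ∑' k, phiOneTerm q A (q ^ n * T) (m + n) k) atTop
      (𝓝 (∑' k : ℕ, if k = 0 then (qPochhammerInf q q)⁻¹ else 0)) := by
    refine tendsto_tsum_of_dominated_convergence
      ((summable_gauss_nat hq1 T).norm.mul_right C) (fun k => ?_)
      (Eventually.of_forall fun n k => ?_)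
    · rcases k with _ | k
      · simp only [phiOneTerm, pow_zero, one_mul, qPochhammer_zero, Nat.cast_zero,
          invPoch_zero, add_zero, if_true, Nat.choose_zero_succ]
        exact (tendsto_invPoch hq1).comp (tendsto_atTop_add_const_left _ m hcast)
      · rw [if_neg k.succ_ne_zero]
        have h1 : Tendsto (fun n : ℕ => (-(q ^ n * T)) ^ (k + 1)) atTop (𝓝 0) := by
          have := (((tendsto_pow_atTop_nhds_zero_of_norm_lt_one hq1).mul_const T).neg).pow (k + 1)
          simpa using this
        have h2 : Tendsto (fun n : ℕ => q ^ (k + 1).choose 2 * (qPochhammer A q (k + 1) *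
            (invPoch q (k + 1 : ℕ) * invPoch q (m + n + (k + 1 : ℕ))))) atTop
            (𝓝 (q ^ (k + 1).choose 2 * (qPochhammer A q (k + 1) *
            (invPoch q (k + 1 : ℕ) * (qPochhammerInf q q)⁻¹)))) := by
          refine Tendsto.const_mul _ (Tendsto.const_mul _ (Tendsto.const_mul _ ?_))
          exact (tendsto_invPoch hq1).comp
            (tendsto_atTop_add_const_right _ _ (tendsto_atTop_add_const_left _ m hcast))
        have h3 := h1.mul h2
        rw [zero_mul] at h3
        exact h3.congr fun n => by rw [phiOneTerm, mul_assoc]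
    · rw [phiOneTerm, norm_mul]
      refine mul_le_mul ?_ (hC _ _ _) (norm_nonneg _) (norm_nonneg _)
      rw [norm_mul, norm_mul, norm_pow, norm_pow, norm_neg, norm_mul, norm_pow, norm_pow T]
      gcongr
      exact mul_le_of_le_one_left (norm_nonneg _) (pow_le_one₀ (norm_nonneg _) hq1.le)
  rw [tsum_ite_eq] at lim
  exact tendsto_nhds_unique (tendsto_const_nhds.congr iter)
    ((tendsto_qPochhammer hq1 T).mul lim)

theorem qPochhammer_add (x q : ℂ) (m n : ℕ) :
    qPochhammer x q (m + n) = qPochhammer x q m * qPochhammer (q ^ m * x) q n := by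
  rw [qPochhammer, Finset.prod_range_add, qPochhammer, qPochhammer]
  congr 1
  refine Finset.prod_congr rfl fun i _ => ?_
  rw [pow_add]; ring

theorem choose_add_two (m n : ℕ) : (m + n).choose 2 = m.choose 2 + n.choose 2 + m * n := by
  have h := c2_add m n
  rw [← Nat.cast_add, c2_nat, c2_nat, c2_nat] at h
  exact_mod_cast h

/-- A limiting case of Bailey's lemma relative to `a = q^e`. -/
theorem hasSum_bailey {q : ℂ} (hq0 : q ≠ 0) (hq1 : ‖q‖ < 1) {ρ t : ℂ} {e : ℕ}
    (h : ρ * t = q ^ (e + 1)) {α β : ℕ → ℂ} {B : ℝ} (hα : ∀ r, ‖α r‖ ≤ B)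
    (hβ : ∀ n : ℕ, ∑ r ∈ Finset.range (n + 1), α r * (invPoch q (n - r) * invPoch q (n + r + e))
      = β n) :
    HasSum (fun n : ℕ => (-t) ^ n * q ^ n.choose 2 * (qPochhammer ρ q n * β n))
      ((qPochhammerInf q q)⁻¹ * ∑' r : ℕ, (-t) ^ r * q ^ r.choose 2 *
        (qPochhammer ρ q r * qPochhammerInf (q ^ r * t) q * α r)) := by
  obtain ⟨C, hC0, hC⟩ := exists_norm_phiOne_le hq1 ρ
  have hB0 : 0 ≤ B := (norm_nonneg _).trans (hα 0)
  -- The double series in (r, k) with n = r + k: its antidiagonal sums give the β-side, its sums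
  -- over k the α-side.
  obtain ⟨F, hF⟩ : ∃ F : ℕ × ℕ → ℂ, ∀ p, F p = (-t) ^ (p.1 + p.2) * q ^ (p.1 + p.2).choose 2 *
      (qPochhammer ρ q (p.1 + p.2) *
        (α p.1 * (invPoch q p.2 * invPoch q (2 * p.1 + e + p.2)))) := ⟨_, fun _ => rfl⟩
  have hs : Summable F := by
    have hg := (summable_gauss_nat hq1 t).norm
    refine Summable.of_norm_bounded ((hg.mul_of_nonneg hg (fun _ => norm_nonneg _)
      (fun _ => norm_nonneg _)).mul_right (B * C)) fun p => ?_
    obtain ⟨r, k⟩ := p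
    rw [hF, mul_left_comm (qPochhammer _ _ _), norm_mul, norm_mul (α _)]
    refine mul_le_mul ?_ (mul_le_mul (hα _) (hC _ _ _) (norm_nonneg _) hB0) (by positivity)
      (by positivity)
    simp only [norm_mul, norm_pow, norm_neg, choose_add_two]
    have h1 : ‖q‖ ^ (r.choose 2 + k.choose 2 + r * k) ≤ ‖q‖ ^ (r.choose 2 + k.choose 2) :=
      pow_le_pow_of_le_one (norm_nonneg _) hq1.le (by omega)
    calc ‖t‖ ^ (r + k) * ‖q‖ ^ (r.choose 2 + k.choose 2 + r * k)
        ≤ ‖t‖ ^ (r + k) * ‖q‖ ^ (r.choose 2 + k.choose 2) := by gcongr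
      _ = _ := by rw [pow_add, pow_add]; ring
  have hr : ∀ r : ℕ, ∑' k : ℕ, F (r, k) = (qPochhammerInf q q)⁻¹ * ((-t) ^ r * q ^ r.choose 2 *
        (qPochhammer ρ q r * qPochhammerInf (q ^ r * t) q * α r)) := fun r => by
    -- For fixed r the sum over k is a ₁φ₁ with A = q^r ρ, T = q^r t and m = 2r + e; this is its
    -- balancing condition.
    have h1 : (q ^ r * ρ) * (q ^ r * t) = q ^ ((2 * r + e : ℤ) + 1) := by
      rw [show (2 * r + e : ℤ) + 1 = ((r + r + (e + 1) : ℕ) : ℤ) by push_cast; ring, zpow_natCast,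
        pow_add, pow_add, ← h]
      ring
    have h2 := tsum_phiOneTerm hq0 hq1 h1
    have h3 : ∀ k, F (r, k) = (-t) ^ r * q ^ r.choose 2 * (qPochhammer ρ q r * α r) *
        phiOneTerm q (q ^ r * ρ) (q ^ r * t) (2 * r + e) k := fun k => by
      rw [hF, phiOneTerm]
      simp only
      rw [qPochhammer_add, choose_add_two, pow_add, pow_add, pow_add, pow_mul,
        neg_mul_eq_mul_neg, mul_pow (q ^ r)]
      ring
    rw [tsum_congr h3, tsum_mul_left, h2]
    ring
  have h1 : HasSum F ((qPochhammerInf q q)⁻¹ * ∑' r : ℕ, (-t) ^ r * q ^ r.choose 2 *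
        (qPochhammer ρ q r * qPochhammerInf (q ^ r * t) q * α r)) := by
    rw [← tsum_mul_left, ← tsum_congr hr, ← hs.tsum_prod]
    exact hs.hasSum
  rw [← Finset.HasAntidiagonal.sigmaAntidiagonalEquivProd.hasSum_iff] at h1
  refine hasSum_of_forall_eq (h1.sigma fun n => hasSum_fintype _) fun n => ?_
  rw [← hβ]
  simp only [Function.comp, Finset.HasAntidiagonal.sigmaAntidiagonalEquivProd_apply]
  rw [Finset.sum_coe_sort (Finset.HasAntidiagonal.antidiagonal n) F,
    Finset.Nat.sum_antidiagonal_eq_sum_range_succ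
    (fun i j => F (i, j)), Finset.mul_sum, Finset.mul_sum]
  refine Finset.sum_congr rfl fun r hr => ?_
  have hrn : r ≤ n := Nat.lt_succ_iff.1 (Finset.mem_range.1 hr)
  rw [hF]
  simp only
  rw [Nat.add_sub_cancel' hrn, Nat.cast_sub hrn,
    show (2 * r + e + (n - r) : ℤ) = n + r + e by ring]

/-! ### The three Bailey pairs. -/

/-- The bound is the fixed point of B = 2 + |q| B. -/
theorem norm_heckeCoeff_le {q : ℂ} (hq1 : ‖q‖ < 1) :
    ∀ n : ℕ, ‖heckeCoeff q n‖ ≤ 2 / (1 - ‖q‖)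
  | 0 => by
    rw [heckeCoeff, norm_zero]
    exact div_nonneg (by norm_num) (by linarith)
  | 1 => by
    rw [heckeCoeff, norm_one, le_div_iff₀ (by linarith)]
    linarith [norm_nonneg q]
  -- Separate because the recursion here has the factor q⁰, which does not contract.
  | 2 => by
    have h : heckeCoeff q 2 = 2 := by simp [heckeCoeff]
    rw [h, le_div_iff₀ (by linarith), Complex.norm_two]
    linarith [norm_nonneg q]
  | n + 3 => by
    have h1 : 0 < 1 - ‖q‖ := by linarith
    have ih := norm_heckeCoeff_le hq1 (n + 1)
    rw [heckeCoeff]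
    calc ‖2 + q ^ (n + 1) * heckeCoeff q (n + 1)‖
        ≤ ‖(2 : ℂ)‖ + ‖q ^ (n + 1) * heckeCoeff q (n + 1)‖ := norm_add_le _ _
      _ ≤ 2 + ‖q‖ * (2 / (1 - ‖q‖)) := by
        rw [norm_mul, norm_pow, Complex.norm_two, pow_succ']
        have : ‖q‖ ^ n ≤ 1 := pow_le_one₀ (norm_nonneg q) hq1.le
        gcongr
        exact mul_le_of_le_one_right (norm_nonneg _) this
      _ = 2 / (1 - ‖q‖) := by field_simp; ring

theorem zpow_natCast_sub {q : ℂ} (hq0 : q ≠ 0) (m n : ℕ) : q ^ ((m : ℤ) - n) = q ^ m / q ^ n := by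
  rw [zpow_sub₀ hq0, zpow_natCast, zpow_natCast]

/-- The `α`-sequence of the Bailey pair relative to `q²` with `β_n = (q)_n / (q)_{2n+1}`. -/
def baileyTwo (q : ℂ) (r : ℕ) : ℂ :=
  (-1) ^ r * q ^ (r + 1).choose 2 * (1 - q ^ 2 * (q ^ r) ^ 2) * heckeCoeff q (r + 1)

/-- Creative telescoping: the difference of the summands is G(r+1) - G(r) for the explicit
certificate `G`. The recursion of `heckeCoeff` eliminates T_{r+3}, leaving a rational identity in
q^N and q^r. -/
theorem sum_baileyTwo_succ {q : ℂ} (hq0 : q ≠ 0) (hq1 : ‖q‖ < 1) (n : ℕ) :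
    (1 + q ^ (n + 1)) * (1 - q * (q ^ (n + 1)) ^ 2) * ∑ r ∈ Finset.range (n + 2),
      baileyTwo q r * (invPoch q ((n + 1 : ℕ) - r) * invPoch q ((n + 1 : ℕ) + r + 2)) =
    ∑ r ∈ Finset.range (n + 1), baileyTwo q r * (invPoch q (n - r) * invPoch q (n + r + 2)) := by
  obtain ⟨N, hN⟩ : ∃ N, N = n + 1 := ⟨_, rfl⟩
  have hn : (n : ℤ) = N - 1 := by rw [hN]; push_cast; ring
  have hX : 1 - q ^ N ≠ 0 := hN ▸ one_sub_pow_ne_zero hq1 n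
  obtain ⟨G, hG⟩ : ∃ G : ℕ → ℂ, ∀ r, G r = (-1) ^ r * q ^ (r + 1).choose 2 *
    (invPoch q (N - r) * invPoch q (N + r + 1)) *
    (-q ^ N * (1 + 1 / q ^ r) * (1 - q * q ^ N * q ^ r) * heckeCoeff q (r + 1) +
      q ^ N * (1 + q * q ^ r) * (1 - q ^ N / q ^ r) * heckeCoeff q (r + 2) -
      2 * q ^ N / (1 - q ^ N) * (q * q ^ r) * (1 - q ^ N / q ^ r) *
        (1 - q ^ N / (q * q ^ r))) := ⟨_, fun _ => rfl⟩
  have hD : ∀ r : ℕ, (1 + q ^ N) * (1 - q * (q ^ N) ^ 2) *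
      (baileyTwo q r * (invPoch q (N - r) * invPoch q (N + r + 2))) -
      baileyTwo q r * (invPoch q (n - r) * invPoch q (n + r + 2)) = G (r + 1) - G r := fun r => by
    have hR := pow_ne_zero r hq0
    have i1 : invPoch q (N - r - 1) = (1 - q ^ N / q ^ r) * invPoch q (N - r) := by
      rw [invPoch_sub_one hq1, zpow_natCast_sub hq0]
    have i2 : invPoch q (N + r + 1) = (1 - q ^ 2 * q ^ N * q ^ r) * invPoch q (N + r + 2) := by
      rw [invPoch_eq hq1, show (N + r + 1 + 1 : ℤ) = ((2 + N + r : ℕ) : ℤ) by push_cast; ring,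
        zpow_natCast, pow_add, pow_add]
      congr 2
      push_cast
      ring
    rw [hG, hG, hn, show (N - 1 - r : ℤ) = N - r - 1 by ring,
      show (N - 1 + r + 2 : ℤ) = N + r + 1 by ring,
      show (N - (r + 1 : ℕ) : ℤ) = N - r - 1 by push_cast; ring,
      show (N + (r + 1 : ℕ) + 1 : ℤ) = N + r + 2 by push_cast; ring, i1, i2, baileyTwo,
      choose_succ_two (r + 1), pow_add q (r + 1), pow_succ q r,
      show r + 1 + 2 = (r + 1) + 2 from rfl, heckeCoeff.eq_3 q (r + 1), pow_succ q r,
      pow_succ (-1 : ℂ) r]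
    field_simp
    ring
  -- Both sums may run up to r = N: the extra term of the sum for n = N - 1 contains `invPoch q
  -- (-1)` = 0.
  have hsum := Finset.sum_range_sub G (N + 1)
  rw [← Finset.sum_congr rfl fun r _ => hD r, Finset.sum_sub_distrib, ← Finset.mul_sum,
    Finset.sum_range_succ (fun r : ℕ => baileyTwo q r * (invPoch q (n - r) * _)), hn,
    show (N - 1 - N : ℤ) = -1 by ring, invPoch_of_neg q (by norm_num : (-1 : ℤ) < 0), zero_mul,
    mul_zero, add_zero, ← hn] at hsum
  have hGN : G (N + 1) = 0 := by
    rw [hG, invPoch_of_neg q (by push_cast; omega)]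
    ring
  have hG0 : G 0 = 0 := by
    have hT2 : heckeCoeff q 2 = 2 := by simp [heckeCoeff]
    have hT1 : heckeCoeff q 1 = 1 := by simp [heckeCoeff]
    rw [hG, zero_add, zero_add, hT1, hT2]
    have : -q ^ N * (1 + 1 / q ^ 0) * (1 - q * q ^ N * q ^ 0) * 1 +
      q ^ N * (1 + q * q ^ 0) * (1 - q ^ N / q ^ 0) * 2 -
      2 * q ^ N / (1 - q ^ N) * (q * q ^ 0) * (1 - q ^ N / q ^ 0) *
        (1 - q ^ N / (q * q ^ 0)) = 0 := by
      rw [pow_zero]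
      field_simp
      ring
    rw [this, mul_zero]
  rw [hGN, hG0, sub_zero, sub_eq_zero, hN] at hsum
  exact hsum

/-- The `α`-sequence of the Bailey pair relative to `1` with `β_n = (q)_n / (q)_{2n}`. -/
def baileyZero (q : ℂ) (r : ℕ) : ℂ :=
  (-1) ^ r * q ^ (r + 1).choose 2 * (heckeCoeff q (r + 1) * (1 - 1 / q ^ r) + 2 / q ^ r) -
    if r = 0 then 1 else 0

/-- Telescoping again, now with a nonzero boundary value at r = 0, which the correction in
`baileyZero` compensates. -/
theorem sum_baileyZero_succ {q : ℂ} (hq0 : q ≠ 0) (hq1 : ‖q‖ < 1) (n : ℕ) :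
    (1 + q ^ (n + 1)) * (1 - (q ^ (n + 1)) ^ 2 / q) * ∑ r ∈ Finset.range (n + 2),
      baileyZero q r * (invPoch q ((n + 1 : ℕ) - r) * invPoch q ((n + 1 : ℕ) + r)) =
    ∑ r ∈ Finset.range (n + 1), baileyZero q r * (invPoch q (n - r) * invPoch q (n + r)) := by
  obtain ⟨N, hN⟩ : ∃ N, N = n + 1 := ⟨_, rfl⟩
  have hn : (n : ℤ) = N - 1 := by rw [hN]; push_cast; ring
  have hX : 1 - q ^ N ≠ 0 := hN ▸ one_sub_pow_ne_zero hq1 n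
  obtain ⟨G, hG⟩ : ∃ G : ℕ → ℂ, ∀ r, G r = (-1) ^ r * q ^ (r + 1).choose 2 *
    (invPoch q (N - r) * invPoch q (N + r - 1)) *
    (q ^ N / (q ^ r) ^ 2 * (1 - q ^ N * q ^ r / q) * heckeCoeff q (r + 1) -
      q ^ N / (q * q ^ r) * (1 - q ^ N / q ^ r) * heckeCoeff q (r + 2) -
      2 * q ^ N * ((1 - 1 / q) / (1 - q ^ N) / q ^ r + (1 + q ^ N / q) / (q ^ r) ^ 2)) :=
    ⟨_, fun _ => rfl⟩
  -- `α` is `baileyZero` without its correction at r = 0; the correction contributes exactly the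
  -- boundary term -G(0).
  obtain ⟨α, hα⟩ : ∃ α : ℕ → ℂ, ∀ r, α r = (-1) ^ r * q ^ (r + 1).choose 2 *
    (heckeCoeff q (r + 1) * (1 - 1 / q ^ r) + 2 / q ^ r) := ⟨_, fun _ => rfl⟩
  have hD : ∀ r : ℕ, (1 + q ^ N) * (1 - (q ^ N) ^ 2 / q) *
      (α r * (invPoch q (N - r) * invPoch q (N + r))) -
      α r * (invPoch q (n - r) * invPoch q (n + r)) = G (r + 1) - G r := fun r => by
    have hR := pow_ne_zero r hq0
    have i1 : invPoch q (N - r - 1) = (1 - q ^ N / q ^ r) * invPoch q (N - r) := by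
      rw [invPoch_sub_one hq1, zpow_natCast_sub hq0]
    have i2 : invPoch q (N + r - 1) = (1 - q ^ N * q ^ r) * invPoch q (N + r) := by
      rw [invPoch_sub_one hq1, ← Nat.cast_add, zpow_natCast, pow_add]
    rw [hG, hG, hn, show (N - 1 - r : ℤ) = N - r - 1 by ring,
      show (N - 1 + r : ℤ) = N + r - 1 by ring,
      show (N - (r + 1 : ℕ) : ℤ) = N - r - 1 by push_cast; ring,
      show (N + (r + 1 : ℕ) - 1 : ℤ) = N + r by push_cast; ring, i1, i2, hα,
      choose_succ_two (r + 1), pow_add q (r + 1), pow_succ q r,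
      show r + 1 + 2 = (r + 1) + 2 from rfl, heckeCoeff.eq_3 q (r + 1), pow_succ q r,
      pow_succ (-1 : ℂ) r]
    field_simp
    ring
  have hsum := Finset.sum_range_sub G (N + 1)
  rw [← Finset.sum_congr rfl fun r _ => hD r, Finset.sum_sub_distrib, ← Finset.mul_sum,
    Finset.sum_range_succ (fun r : ℕ => α r * (invPoch q (n - r) * _)), hn,
    show (N - 1 - N : ℤ) = -1 by ring, invPoch_of_neg q (by norm_num : (-1 : ℤ) < 0), zero_mul,
    mul_zero, add_zero, ← hn] at hsum
  have hGN : G (N + 1) = 0 := by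
    rw [hG, invPoch_of_neg q (by push_cast; omega)]
    ring
  have hip : invPoch q n = (1 - q ^ N) * invPoch q N := by
    rw [hn, invPoch_sub_one hq1, zpow_natCast]
  have hG0 : (1 + q ^ N) * (1 - (q ^ N) ^ 2 / q) * (invPoch q N * invPoch q N) -
      invPoch q n * invPoch q n = -G 0 := by
    have hT2 : heckeCoeff q 2 = 2 := by simp [heckeCoeff]
    have hT1 : heckeCoeff q 1 = 1 := by simp [heckeCoeff]
    rw [hG, zero_add, zero_add, hT1, hT2, Nat.cast_zero, sub_zero, add_zero, ← hn, hip]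
    norm_num
    field_simp
    ring
  have hsplit : ∀ (m M : ℕ), ∑ r ∈ Finset.range (m + 1),
      baileyZero q r * (invPoch q (M - r) * invPoch q (M + r)) =
      ∑ r ∈ Finset.range (m + 1), α r * (invPoch q (M - r) * invPoch q (M + r)) -
        invPoch q M * invPoch q M := fun m M => by
    rw [Finset.sum_range_succ', Finset.sum_range_succ']
    simp only [baileyZero, hα, Nat.succ_ne_zero, if_false, sub_zero, if_true, Nat.cast_zero,
      add_zero]
    ring
  rw [hsplit (n + 1) (n + 1), hsplit n n]
  rw [hN] at hsum hG0 hGN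
  linear_combination hsum + hGN - hG0

theorem one_add_pow_ne_zero {q : ℂ} (hq1 : ‖q‖ < 1) (n : ℕ) : 1 + q ^ (n + 1) ≠ 0 := by
  have := (one_sub_zpow_ne_zero hq1 (k := (n + 1 : ℕ)) (by positivity)).2
  rwa [zpow_natCast] at this

theorem sum_baileyTwo {q : ℂ} (hq0 : q ≠ 0) (hq1 : ‖q‖ < 1) (n : ℕ) :
    ∑ r ∈ Finset.range (n + 1), baileyTwo q r * (invPoch q (n - r) * invPoch q (n + r + 2)) =
      qPochhammer q q n * invPoch q (2 * n + 1) := by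
  induction n with
  | zero =>
    have h := invPoch_eq hq1 1
    rw [show (1 + 1 : ℤ) = (2 : ℕ) by norm_num, zpow_natCast] at h
    simp [baileyTwo, heckeCoeff, qPochhammer_zero, invPoch_zero]
    rw [h]
    norm_num
  | succ n ih =>
    have h1 := one_add_pow_ne_zero hq1 n
    have h2 : 1 - q * (q ^ (n + 1)) ^ 2 ≠ 0 := by
      rw [← pow_mul, ← pow_succ']; exact one_sub_pow_ne_zero hq1 _
    refine mul_left_cancel₀ (mul_ne_zero h1 h2) ?_
    rw [sum_baileyTwo_succ hq0 hq1, ih, qPochhammer_succ, invPoch_eq hq1 (2 * n + 1),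
      invPoch_eq hq1 (2 * n + 1 + 1),
      show (2 * n + 1 + 1 : ℤ) = ((2 * (n + 1) : ℕ) : ℤ) by push_cast; ring,
      show (2 * (n + 1 : ℕ) + 1 : ℤ) = ((2 * (n + 1) + 1 : ℕ) : ℤ) by push_cast; ring,
      ← Nat.cast_succ, zpow_natCast, zpow_natCast, Nat.succ_eq_add_one]
    ring

theorem sum_baileyZero {q : ℂ} (hq0 : q ≠ 0) (hq1 : ‖q‖ < 1) (n : ℕ) :
    ∑ r ∈ Finset.range (n + 1), baileyZero q r * (invPoch q (n - r) * invPoch q (n + r)) =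
      qPochhammer q q n * invPoch q (2 * n) := by
  induction n with
  | zero =>
    simp [baileyZero, heckeCoeff, qPochhammer_zero, invPoch_zero]
    norm_num
  | succ n ih =>
    have h1 := one_add_pow_ne_zero hq1 n
    have h3 : (q ^ (n + 1)) ^ 2 / q = q ^ (2 * n + 1) := by
      rw [← pow_mul, show (n + 1) * 2 = 2 * n + 1 + 1 by ring, pow_succ, mul_div_assoc,
        div_self hq0, mul_one]
    have h2 := one_sub_pow_ne_zero hq1 (2 * n)
    have h4 := sum_baileyZero_succ hq0 hq1 n
    rw [h3] at h4
    refine mul_left_cancel₀ (mul_ne_zero h1 h2) ?_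
    rw [h4, ih, qPochhammer_succ, invPoch_eq hq1 (2 * n),
      invPoch_eq hq1 (2 * n + 1),
      show (2 * n + 1 + 1 : ℤ) = ((2 * (n + 1) : ℕ) : ℤ) by push_cast; ring,
      show (2 * (n + 1 : ℕ) : ℤ) = ((2 * (n + 1) : ℕ) : ℤ) by push_cast; ring,
      show (2 * n + 1 : ℤ) = ((2 * n + 1 : ℕ) : ℤ) by push_cast; ring,
      zpow_natCast, zpow_natCast]
    ring

/-- The `α`-sequence of the Bailey pair relative to `q` with `β_n = (q)_n / (q)_{2n+1}`. -/
def baileyOne (q : ℂ) (r : ℕ) : ℂ :=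
  (-1) ^ r * q ^ (r + 1).choose 2 * (heckeCoeff q (r + 1) + q ^ r * heckeCoeff q r)

/-- Passing from a = q² to a = q leaves β unchanged: the summands differ by h(r+1) - h(r), with h(0)
= 0 because T_0 = 0 and h(n+1) = 0 because of `invPoch`. -/
theorem sum_baileyOne {q : ℂ} (hq0 : q ≠ 0) (hq1 : ‖q‖ < 1) (n : ℕ) :
    ∑ r ∈ Finset.range (n + 1), baileyOne q r * (invPoch q (n - r) * invPoch q (n + r + 1)) =
      qPochhammer q q n * invPoch q (2 * n + 1) := by
  obtain ⟨h, hh⟩ : ∃ h : ℕ → ℂ, ∀ r, h r = (-1) ^ r * q ^ (r + 1).choose 2 *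
    (q ^ r * heckeCoeff q r) * (invPoch q (n - r) * invPoch q (n + r + 1)) := ⟨_, fun _ => rfl⟩
  have e : ∀ r : ℕ, baileyTwo q r * (invPoch q (n - r) * invPoch q (n + r + 2)) =
      (baileyOne q r * (invPoch q (n - r) * invPoch q (n + r + 1)) - h r) + h (r + 1) := fun r => by
    have i1 : q ^ ((n : ℤ) - r) * q ^ (2 * r + 2) = q ^ (n + r + 2) := by
      rw [← zpow_natCast, ← zpow_natCast, ← zpow_add₀ hq0]
      congr 1
      push_cast
      ring
    have i2 := invPoch_sub_one hq1 (n - r)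
    have i3 := invPoch_sub_one hq1 (n + r + 2)
    rw [show (n + r + 2 : ℤ) = ((n + r + 2 : ℕ) : ℤ) by push_cast; ring, zpow_natCast] at i3
    rw [hh, hh, baileyTwo, baileyOne, show (n - (r + 1 : ℕ) : ℤ) = n - r - 1 by push_cast; ring,
      show (n + (r + 1 : ℕ) + 1 : ℤ) = ((n + r + 2 : ℕ) : ℤ) by push_cast; ring,
      show (n + r + 2 : ℤ) = ((n + r + 2 : ℕ) : ℤ) by push_cast; ring,
      show (n + r + 1 : ℤ) = ((n + r + 2 : ℕ) : ℤ) - 1 by push_cast; ring, i2, i3,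
      choose_succ_two (r + 1), ← i1]
    ring
  have h0 : h 0 = 0 := by rw [hh, heckeCoeff]; ring
  have hn : h (n + 1) = 0 := by
    rw [hh, invPoch_of_neg q (by push_cast; omega)]; ring
  rw [← sum_baileyTwo hq0 hq1, Finset.sum_congr rfl fun r _ => e r, Finset.sum_add_distrib,
    Finset.sum_sub_distrib]
  have h1 := Finset.sum_range_succ h (n + 1)
  rw [Finset.sum_range_succ', h0, hn, add_zero, add_zero] at h1
  rw [h1]
  ring

theorem norm_sign_mul_pow_mul_le {q : ℂ} (hq1 : ‖q‖ < 1) (m n : ℕ) (u : ℂ) :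
    ‖(-1) ^ m * q ^ n * u‖ ≤ ‖u‖ := by
  rw [norm_mul, norm_mul, norm_pow, norm_pow, norm_neg, norm_one, one_pow, one_mul]
  exact mul_le_of_le_one_left (norm_nonneg _) (pow_le_one₀ (norm_nonneg _) hq1.le)

theorem norm_one_sub_pow_le {q : ℂ} (hq1 : ‖q‖ < 1) (n : ℕ) : ‖1 - q ^ n‖ ≤ 2 := by
  refine (norm_sub_le _ _).trans ?_
  rw [norm_one, norm_pow]
  linarith [pow_le_one₀ (n := n) (norm_nonneg q) hq1.le]

theorem exists_norm_baileyTwo_le {q : ℂ} (hq1 : ‖q‖ < 1) : ∃ B, ∀ r, ‖baileyTwo q r‖ ≤ B := by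
  refine ⟨2 * (2 / (1 - ‖q‖)), fun r => ?_⟩
  rw [baileyTwo, mul_assoc]
  refine (norm_sign_mul_pow_mul_le hq1 _ _ _).trans ?_
  rw [norm_mul, ← pow_mul, ← pow_add]
  exact mul_le_mul (norm_one_sub_pow_le hq1 _) (norm_heckeCoeff_le hq1 _) (norm_nonneg _)
    (by norm_num)

theorem exists_norm_baileyOne_le {q : ℂ} (hq1 : ‖q‖ < 1) : ∃ B, ∀ r, ‖baileyOne q r‖ ≤ B := by
  refine ⟨2 / (1 - ‖q‖) + 2 / (1 - ‖q‖), fun r => ?_⟩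
  rw [baileyOne]
  refine (norm_sign_mul_pow_mul_le hq1 _ _ _).trans ((norm_add_le _ _).trans ?_)
  refine add_le_add (norm_heckeCoeff_le hq1 _) (le_trans ?_ (norm_heckeCoeff_le hq1 r))
  simpa using norm_sign_mul_pow_mul_le hq1 0 r (heckeCoeff q r)

/-- Absorbs the negative powers of q into the Gaussian factor, which makes boundedness visible. -/
theorem baileyZero_eq {q : ℂ} (hq0 : q ≠ 0) (r : ℕ) : baileyZero q r =
    (-1) ^ r * q ^ r.choose 2 * (2 - (1 - q ^ r) * heckeCoeff q (r + 1)) -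
      if r = 0 then 1 else 0 := by
  rw [baileyZero, choose_succ_two, pow_add]
  field_simp
  ring

theorem exists_norm_baileyZero_le {q : ℂ} (hq0 : q ≠ 0) (hq1 : ‖q‖ < 1) :
    ∃ B, ∀ r, ‖baileyZero q r‖ ≤ B := by
  refine ⟨2 + 2 * (2 / (1 - ‖q‖)) + 1, fun r => ?_⟩
  rw [baileyZero_eq hq0]
  refine (norm_sub_le _ _).trans (add_le_add ?_ (by split_ifs <;> simp))
  refine (norm_sign_mul_pow_mul_le hq1 _ _ _).trans ((norm_sub_le _ _).trans ?_)
  rw [Complex.norm_two, norm_mul]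
  gcongr
  · exact norm_one_sub_pow_le hq1 _
  · exact norm_heckeCoeff_le hq1 _

/-! ### Product identities and special theta values. -/

theorem qPochhammer_mul_neg (q : ℂ) (n : ℕ) :
    qPochhammer q q n * qPochhammer (-q) q n = qPochhammer (q ^ 2) (q ^ 2) n := by
  induction n with
  | zero => simp [qPochhammer_zero]
  | succ n ih => rw [qPochhammer_succ, qPochhammer_succ, qPochhammer_succ, ← ih]; ring

theorem qPochhammer_two_mul (q : ℂ) (n : ℕ) :
    qPochhammer q q (2 * n) = qPochhammer q (q ^ 2) n * qPochhammer (q ^ 2) (q ^ 2) n := by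
  induction n with
  | zero => simp [qPochhammer_zero]
  | succ n ih =>
    rw [show 2 * (n + 1) = 2 * n + 1 + 1 by ring, qPochhammer_succ, qPochhammer_succ, ih,
      qPochhammer_succ, qPochhammer_succ]
    ring

theorem qPochhammer_two_mul_add_one (q : ℂ) (n : ℕ) : qPochhammer q q (2 * n + 1) =
    qPochhammer q (q ^ 2) (n + 1) * qPochhammer (q ^ 2) (q ^ 2) n := by
  rw [qPochhammer_succ, qPochhammer_two_mul, qPochhammer_succ]
  ring

theorem qPochhammer_mul_qPochhammerInf {q : ℂ} (hq1 : ‖q‖ < 1) (x : ℂ) (r : ℕ) :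
    qPochhammer x q r * qPochhammerInf (q ^ r * x) q = qPochhammerInf x q := by
  refine tendsto_nhds_unique ((tendsto_qPochhammer hq1 (q ^ r * x)).const_mul _)
    (((tendsto_qPochhammer hq1 x).comp (tendsto_add_atTop_nat r)).congr fun n => ?_)
  rw [Function.comp, add_comm, qPochhammer_add]

theorem qPochhammerInf_mul_neg {q : ℂ} (hq1 : ‖q‖ < 1) :
    qPochhammerInf q q * qPochhammerInf (-q) q = qPochhammerInf (q ^ 2) (q ^ 2) :=
  tendsto_nhds_unique ((tendsto_qPochhammer hq1 q).mul (tendsto_qPochhammer hq1 (-q)))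
    ((tendsto_qPochhammer (norm_pow_lt_one hq1 two_ne_zero) _).congr fun n =>
      (qPochhammer_mul_neg q n).symm)

/-- Euler's identity `(-q; q)_∞ (q; q²)_∞ = 1`. -/
theorem qPochhammerInf_neg_mul_odd {q : ℂ} (hq1 : ‖q‖ < 1) :
    qPochhammerInf (-q) q * qPochhammerInf q (q ^ 2) = 1 := by
  have h2 := norm_pow_lt_one hq1 (k := 2) two_ne_zero
  have h : qPochhammerInf q (q ^ 2) * qPochhammerInf (q ^ 2) (q ^ 2) = qPochhammerInf q q :=
    tendsto_nhds_unique ((tendsto_qPochhammer h2 q).mul (tendsto_qPochhammer h2 (q ^ 2)))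
      (((tendsto_qPochhammer hq1 q).comp
        (tendsto_id.const_mul_atTop' (two_pos : (0 : ℕ) < 2))).congr fun n =>
        qPochhammer_two_mul q n)
  rw [← qPochhammerInf_mul_neg hq1] at h
  refine mul_left_cancel₀ (qPochhammerInf_self_ne_zero hq1) ?_
  linear_combination h

theorem thetaSeries_self_sq {q : ℂ} (hq0 : q ≠ 0) (hq1 : ‖q‖ < 1) :
    thetaSeries q (q ^ 2) * qPochhammerInf (-q) q = qPochhammerInf q q := by
  have e : q ^ 2 / q = q := by field_simp
  rw [← theta_eq_thetaSeries (pow_ne_zero 2 hq0) (norm_pow_lt_one hq1 two_ne_zero) hq0, theta, e,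
    ← qPochhammerInf_mul_neg hq1]
  have h := qPochhammerInf_neg_mul_odd hq1
  linear_combination qPochhammerInf q q *
    (qPochhammerInf (-q) q * qPochhammerInf q (q ^ 2) + 1) * h

theorem thetaSeries_neg_self {q : ℂ} (hq0 : q ≠ 0) (hq1 : ‖q‖ < 1) :
    thetaSeries (-q) q * qPochhammerInf q (q ^ 2) = 2 * qPochhammerInf (q ^ 2) (q ^ 2) := by
  have h1 : qPochhammerInf (-1) q = 2 * qPochhammerInf (-q) q := by
    rw [← qPochhammer_mul_qPochhammerInf hq1 (-1) 1, qPochhammer_succ, qPochhammer_zero]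
    norm_num
  rw [← theta_eq_thetaSeries hq0 hq1 (neg_ne_zero.2 hq0), theta, div_neg, div_self hq0, h1,
    ← qPochhammerInf_mul_neg hq1]
  have h := qPochhammerInf_neg_mul_odd hq1
  linear_combination 2 * qPochhammerInf q q * qPochhammerInf (-q) q * h

/-! ### The mock theta functions as Hecke-type sums. -/

theorem two_mul_choose_two (n : ℕ) : 2 * ((n.choose 2 : ℕ) : ℤ) = n * (n - 1) := by
  rw [← c2_nat, two_mul_c2]

theorem neg_zpow_neg_sub_two (x : ℂ) (n : ℕ) :
    (-x) ^ (-(n : ℤ) - 2) = (-1) ^ n * x ^ (-(n : ℤ) - 2) := by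
  rw [neg_eq_neg_one_mul, mul_zpow, zpow_sub₀ (by norm_num), zpow_neg, ← inv_zpow, zpow_natCast]
  norm_num

theorem invPoch_natCast_two_mul_add_one (q : ℂ) (n : ℕ) :
    invPoch q (2 * n + 1) = (qPochhammer q q (2 * n + 1))⁻¹ := by
  rw [← invPoch_natCast]; push_cast; rfl

theorem qPochhammer_self_ne_zero {q : ℂ} (hq1 : ‖q‖ < 1) (n : ℕ) : qPochhammer q q n ≠ 0 :=
  qPochhammer_ne_zero hq1 hq1.le n

theorem qPochhammer_neg_ne_zero {q : ℂ} (hq1 : ‖q‖ < 1) (n : ℕ) : qPochhammer (-q) q n ≠ 0 :=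
  qPochhammer_ne_zero (by rwa [norm_neg]) hq1.le n

theorem qPochhammer_odd_ne_zero {q : ℂ} (hq1 : ‖q‖ < 1) (n : ℕ) :
    qPochhammer q (q ^ 2) n ≠ 0 :=
  qPochhammer_ne_zero hq1 (norm_pow_lt_one hq1 two_ne_zero).le n

theorem qPochhammer_neg_mul_eq {q : ℂ} (hq1 : ‖q‖ < 1) (n : ℕ) :
    qPochhammer (-q) q n * (qPochhammer q q n * invPoch q (2 * n + 1)) =
      (qPochhammer q (q ^ 2) (n + 1))⁻¹ := by
  have h0 := qPochhammer_self_ne_zero hq1 n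
  have h1 := qPochhammer_neg_ne_zero hq1 n
  have h2 := qPochhammer_odd_ne_zero hq1 (n + 1)
  rw [invPoch_natCast_two_mul_add_one, qPochhammer_two_mul_add_one, ← qPochhammer_mul_neg]
  field_simp

/-- Bailey's lemma with a = q and ρ = t = -q, since (-q)_n β_n = 1/(q;q²)_{n+1}. -/
theorem hasSum_phi {q : ℂ} (hq0 : q ≠ 0) (hq1 : ‖q‖ < 1) :
    Summable (phiTerm q) ∧ thetaSeries q (q ^ 2) * phi q = heckeSum (q ^ 2) q := by
  obtain ⟨B, hB⟩ := exists_norm_baileyOne_le hq1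
  have h := hasSum_bailey hq0 hq1 (ρ := -q) (t := -q) (e := 1) (by ring) hB
    (fun n => sum_baileyOne hq0 hq1 n)
  have h' := hasSum_of_forall_eq (g := phiTerm q) h fun n => by
    rw [qPochhammer_neg_mul_eq hq1, phiTerm, neg_neg, choose_succ_two, pow_add, div_eq_mul_inv]
  refine ⟨h'.summable, ?_⟩
  obtain ⟨u, hu⟩ : ∃ u : ℕ → ℂ, ∀ r, u r = q ^ r * q ^ r.choose 2 *
    ((-1) ^ r * q ^ (r + 1).choose 2 * heckeCoeff q (r + 1)) := ⟨_, fun _ => rfl⟩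
  obtain ⟨v, hv⟩ : ∃ v : ℕ → ℂ, ∀ r, v r = q ^ r * q ^ r.choose 2 *
    ((-1) ^ r * q ^ ((r + 1).choose 2 + r) * heckeCoeff q r) := ⟨_, fun _ => rfl⟩
  have su : Summable u := (summable_gauss_nat_mul_bounded hq1 q fun r =>
    (norm_sign_mul_pow_mul_le hq1 _ _ _).trans (norm_heckeCoeff_le hq1 (r + 1))).congr
    fun r => (hu r).symm
  have sv : Summable v := (summable_gauss_nat_mul_bounded hq1 q fun r =>
    (norm_sign_mul_pow_mul_le hq1 _ _ _).trans (norm_heckeCoeff_le hq1 r)).congr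
    fun r => (hv r).symm
  have hv0 : v 0 = 0 := by rw [hv, heckeCoeff]; ring
  have e1 : ∀ r : ℕ, (- -q) ^ r * q ^ r.choose 2 *
      (qPochhammer (-q) q r * qPochhammerInf (q ^ r * -q) q * baileyOne q r) =
      qPochhammerInf (-q) q * (u r + v r) := fun r => by
    rw [qPochhammer_mul_qPochhammerInf hq1, baileyOne, hu, hv, neg_neg, pow_add]
    ring
  -- The part `v` carries T_r and vanishes at r = 0; shifted by one it carries T_{r+1} and becomes
  -- the second half of `heckeSum`.
  have e2 : heckeSum (q ^ 2) q = ∑' r, (u r + v r) := by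
    rw [su.tsum_add sv, sv.tsum_eq_zero_add, hv0, zero_add,
      ← su.tsum_add ((summable_nat_add_iff 1).2 sv), heckeSum]
    refine tsum_congr fun n => ?_
    have c1 : q ^ (2 * c2 n) * (q ^ 2) ^ n = q ^ n * q ^ n.choose 2 * q ^ (n + 1).choose 2 := by
      rw [c2_nat, choose_succ_two]
      norm_cast
      ring
    have c2' : (q ^ 2) ^ (-(n : ℤ) - 2) * q ^ (2 * c2 n + 7 * n + 7) =
        q ^ (n + 1) * q ^ (n + 1).choose 2 * q ^ ((n + 1 + 1).choose 2 + (n + 1)) := by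
      rw [pow_natCast_zpow, ← zpow_add₀ hq0, ← pow_add, ← pow_add, ← zpow_natCast]
      have h1 := two_mul_c2 n
      have h2 := two_mul_choose_two (n + 1)
      have h3 := two_mul_choose_two (n + 1 + 1)
      congr 1
      push_cast at h2 h3 ⊢
      linarith
    rw [hu, hv, neg_pow (q ^ 2), neg_zpow_neg_sub_two,
      mul_assoc ((-1 : ℂ) ^ n) ((q ^ 2) ^ (-(n : ℤ) - 2)), c2', pow_succ (-1 : ℂ)]
    linear_combination (-1) ^ n * heckeCoeff q (n + 1) * c1
  have h3 := h'.tsum_eq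
  rw [tsum_congr e1, tsum_mul_left, ← e2] at h3
  rw [phi, h3]
  have k := thetaSeries_self_sq hq0 hq1
  have hQ := qPochhammerInf_self_ne_zero hq1
  field_simp
  linear_combination heckeSum (q ^ 2) q * k

/-- Bailey's lemma with a = q², ρ = -q and t = -q². The factor 1 - q^{2r+2} of α splits: 1 + q^{r+1}
completes the product (-q)_∞, and 1 - q^{r+1} yields the two halves of `heckeSum`. -/
theorem hasSum_psi {q : ℂ} (hq0 : q ≠ 0) (hq1 : ‖q‖ < 1) :
    Summable (psiTerm q) ∧ thetaSeries q (q ^ 2) * psi q = q * heckeSum (q ^ 3) q := by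
  obtain ⟨B, hB⟩ := exists_norm_baileyTwo_le hq1
  have h := hasSum_bailey hq0 hq1 (ρ := -q) (t := -q ^ 2) (e := 2) (by ring) hB
    (fun n => sum_baileyTwo hq0 hq1 n)
  have h' := hasSum_of_forall_eq (g := psiTerm q) (h.mul_left q) fun n => by
    rw [qPochhammer_neg_mul_eq hq1, psiTerm, neg_neg, choose_succ_two (n + 1), choose_succ_two n,
      ← pow_mul, div_eq_mul_inv]
    ring
  refine ⟨h'.summable, ?_⟩
  have e1 : ∀ r : ℕ, (- -q ^ 2) ^ r * q ^ r.choose 2 *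
      (qPochhammer (-q) q r * qPochhammerInf (q ^ r * -q ^ 2) q * baileyTwo q r) =
      qPochhammerInf (-q) q * (((-(q ^ 3)) ^ r * q ^ (2 * c2 r) -
        (-(q ^ 3)) ^ (-(r : ℤ) - 2) * q ^ (2 * c2 r + 7 * r + 7)) * heckeCoeff q (r + 1)) :=
      fun r => by
    have k := qPochhammer_mul_qPochhammerInf hq1 (-q) (r + 1)
    rw [qPochhammer_succ, show q ^ (r + 1) * -q = q ^ r * -q ^ 2 by ring] at k
    have c1 : q ^ (2 * c2 r) * (q ^ 3) ^ r =
        (q ^ 2) ^ r * q ^ r.choose 2 * q ^ (r + 1).choose 2 := by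
      rw [c2_nat, choose_succ_two]
      norm_cast
      ring
    have c2' : (q ^ 3) ^ (-(r : ℤ) - 2) * q ^ (2 * c2 r + 7 * r + 7) =
        (q ^ 2) ^ r * q ^ r.choose 2 * q ^ (r + 1).choose 2 * q ^ (r + 1) := by
      rw [pow_natCast_zpow, ← zpow_add₀ hq0, ← pow_mul, ← pow_add, ← pow_add, ← pow_add,
        ← zpow_natCast]
      have h1 := two_mul_c2 r
      have h2 := two_mul_choose_two r
      have h3 := two_mul_choose_two (r + 1)
      congr 1
      push_cast at h2 h3 ⊢
      linarith
    rw [neg_pow (q ^ 3), neg_zpow_neg_sub_two,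
      mul_assoc ((-1 : ℂ) ^ r) ((q ^ 3) ^ (-(r : ℤ) - 2)), c2', baileyTwo, ← k, neg_neg]
    linear_combination -(qPochhammer (-q) q r * (1 - q ^ r * -q) *
      qPochhammerInf (q ^ r * -q ^ 2) q) * (-1) ^ r * heckeCoeff q (r + 1) * c1
  have h3 := h'.tsum_eq
  rw [tsum_congr e1, tsum_mul_left, ← heckeSum] at h3
  rw [psi, h3]
  have k := thetaSeries_self_sq hq0 hq1
  have hQ := qPochhammerInf_self_ne_zero hq1
  field_simp
  linear_combination heckeSum (q ^ 3) q * k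

/-- Bailey's lemma in base q² with a = q⁴ and ρ = t = q³; the factor 1 - q^{4r+4} of α yields the
two halves of `heckeSum`. -/
theorem hasSum_chi {q : ℂ} (hq0 : q ≠ 0) (hq1 : ‖q‖ < 1) :
    Summable (chiTerm q) ∧
      qPochhammerInf (q ^ 2) (q ^ 2) * chi q =
        qPochhammerInf q (q ^ 2) * (q * heckeSum (-(q * (q ^ 2) ^ 2)) (q ^ 2)) := by
  have hb0 := pow_ne_zero 2 hq0
  have hb1 := norm_pow_lt_one hq1 (k := 2) two_ne_zero
  obtain ⟨B, hB⟩ := exists_norm_baileyTwo_le hb1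
  have hodd : ∀ n : ℕ, qPochhammer q (q ^ 2) (n + 1) =
      (1 - q) * qPochhammer (q ^ 3) (q ^ 2) n := fun n => by
    rw [add_comm, qPochhammer_add, qPochhammer_succ, qPochhammer_zero, pow_one, pow_zero, one_mul,
      one_mul, ← pow_succ]
  have h := hasSum_bailey hb0 hb1 (ρ := q ^ 3) (t := q ^ 3) (e := 2) (by ring) hB
    (fun n => sum_baileyTwo hb0 hb1 n)
  have h' := hasSum_of_forall_eq (g := chiTerm q) (h.mul_left (q * (1 - q))) fun n => by
    have k1 := qPochhammer_self_ne_zero hb1 n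
    have k2 := qPochhammer_neg_ne_zero hq1 (2 * n + 1)
    have k3 := qPochhammer_odd_ne_zero hq1 (n + 1)
    have k4 : 1 - q ≠ 0 := by simpa using one_sub_pow_ne_zero hq1 0
    have k5 : qPochhammer (q ^ 3) (q ^ 2) n ≠ 0 := right_ne_zero_of_mul (hodd n ▸ k3)
    have e1 : q * (q ^ 3) ^ n * (q ^ 2) ^ n.choose 2 = q ^ (n + 1) ^ 2 := by
      rw [← pow_mul, ← pow_mul, ← pow_succ', ← pow_add]
      have h2 := two_mul_choose_two n
      congr 1
      zify
      linarith
    rw [invPoch_natCast_two_mul_add_one, ← qPochhammer_mul_neg q (2 * n + 1),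
      qPochhammer_two_mul_add_one q n, hodd,
      chiTerm, ← e1, neg_pow]
    field_simp
  refine ⟨h'.summable, ?_⟩
  have e1 : ∀ r : ℕ, (-q ^ 3) ^ r * (q ^ 2) ^ r.choose 2 *
      (qPochhammer (q ^ 3) (q ^ 2) r * qPochhammerInf ((q ^ 2) ^ r * q ^ 3) (q ^ 2) *
        baileyTwo (q ^ 2) r) =
      qPochhammerInf (q ^ 3) (q ^ 2) * (((- -(q * (q ^ 2) ^ 2)) ^ r * (q ^ 2) ^ (2 * c2 r) -
        (- -(q * (q ^ 2) ^ 2)) ^ (-(r : ℤ) - 2) * (q ^ 2) ^ (2 * c2 r + 7 * r + 7)) *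
          heckeCoeff (q ^ 2) (r + 1)) := fun r => by
    have c0 : q * (q ^ 2) ^ 2 = q ^ 5 := by ring
    have c1 : (q ^ 5) ^ r * (q ^ 2) ^ (2 * c2 r) =
        (q ^ 3) ^ r * (q ^ 2) ^ r.choose 2 * (q ^ 2) ^ (r + 1).choose 2 := by
      rw [c2_nat, choose_succ_two]
      norm_cast
      ring
    have c2' : (q ^ 5) ^ (-(r : ℤ) - 2) * (q ^ 2) ^ (2 * c2 r + 7 * r + 7) =
        (q ^ 3) ^ r * (q ^ 2) ^ r.choose 2 * (q ^ 2) ^ (r + 1).choose 2 * q ^ (4 * r + 4) := by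
      rw [pow_natCast_zpow, pow_natCast_zpow, ← zpow_add₀ hq0, ← pow_mul, ← pow_mul, ← pow_mul,
        ← pow_add, ← pow_add, ← pow_add, ← zpow_natCast]
      have h1 := two_mul_c2 r
      have h2 := two_mul_choose_two r
      have h3 := two_mul_choose_two (r + 1)
      congr 1
      push_cast at h2 h3 ⊢
      linarith
    have c3 : (-1 : ℂ) ^ r * (-1) ^ r = 1 := by rw [← mul_pow]; norm_num
    rw [qPochhammer_mul_qPochhammerInf hb1, neg_neg, c0, c2', c1, baileyTwo, neg_pow]
    linear_combination (q ^ 3) ^ r * (q ^ 2) ^ r.choose 2 * qPochhammerInf (q ^ 3) (q ^ 2) *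
      ((q ^ 2) ^ (r + 1).choose 2 * (1 - (q ^ 2) ^ 2 * ((q ^ 2) ^ r) ^ 2) *
        heckeCoeff (q ^ 2) (r + 1)) * c3
  have h3 := h'.tsum_eq
  rw [tsum_congr e1, tsum_mul_left] at h3
  have k := qPochhammer_mul_qPochhammerInf hb1 q 1
  rw [hodd 0, qPochhammer_zero, pow_one, ← pow_succ] at k
  have hQ := qPochhammerInf_self_ne_zero hb1
  rw [chi, h3, heckeSum, ← k]
  field_simp

/-- Bailey's lemma in base q² with a = 1 and ρ = t = q. -/
theorem hasSum_bigX {q : ℂ} (hq0 : q ≠ 0) (hq1 : ‖q‖ < 1) :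
    Summable (bigXTerm q) ∧
      qPochhammerInf (q ^ 2) (q ^ 2) * bigX q =
        qPochhammerInf q (q ^ 2) * heckeSum (-(q * q ^ 2)) (q ^ 2) := by
  have hb0 := pow_ne_zero 2 hq0
  have hb1 := norm_pow_lt_one hq1 (k := 2) two_ne_zero
  obtain ⟨B, hB⟩ := exists_norm_baileyZero_le hb0 hb1
  have h := hasSum_bailey hb0 hb1 (ρ := q) (t := q) (e := 0) (by ring) hB
    (fun n => by simpa using sum_baileyZero hb0 hb1 n)
  have h' := hasSum_of_forall_eq (g := bigXTerm q) h fun n => by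
    have k1 := qPochhammer_self_ne_zero hb1 n
    have k2 := qPochhammer_neg_ne_zero hq1 (2 * n)
    have k3 := qPochhammer_odd_ne_zero hq1 n
    have e1 : q ^ n * (q ^ 2) ^ n.choose 2 = q ^ n ^ 2 := by
      rw [← pow_mul, ← pow_add]
      have h2 := two_mul_choose_two n
      congr 1
      zify
      linarith
    rw [show (2 * n : ℤ) = ((2 * n : ℕ) : ℤ) by push_cast; rfl, invPoch_natCast,
      ← qPochhammer_mul_neg q (2 * n), qPochhammer_two_mul q n, bigXTerm, ← e1, neg_pow]
    field_simp
  refine ⟨h'.summable, ?_⟩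
  obtain ⟨w, hw⟩ : ∃ w : ℕ → ℂ, ∀ r, w r = (-q) ^ r * (q ^ 2) ^ r.choose 2 * baileyZero (q ^ 2) r :=
    ⟨_, fun _ => rfl⟩
  obtain ⟨u, hu⟩ : ∃ u : ℕ → ℂ, ∀ r, u r = q ^ r * (q ^ 2) ^ r.choose 2 *
    ((-1) ^ 0 * (q ^ 2) ^ (r + 1).choose 2 * heckeCoeff (q ^ 2) (r + 1)) := ⟨_, fun _ => rfl⟩
  have sw : Summable w := (summable_gauss_nat_mul_bounded hb1 (-q) hB).congr fun r => (hw r).symm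
  have su : Summable u := (summable_gauss_nat_mul_bounded hb1 q fun r =>
    (norm_sign_mul_pow_mul_le hb1 _ _ _).trans (norm_heckeCoeff_le hb1 (r + 1))).congr
    fun r => (hu r).symm
  have hv : ∀ r, w r - u r = q ^ r * ((q ^ 2) ^ r.choose 2) ^ 2 *
      (2 - heckeCoeff (q ^ 2) (r + 1)) - if r = 0 then 1 else 0 := fun r => by
    have c3 : (-1 : ℂ) ^ r * (-1) ^ r = 1 := by rw [← mul_pow]; norm_num
    rw [hw, hu, baileyZero_eq hb0, neg_pow, choose_succ_two, pow_add (q ^ 2) r]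
    split_ifs with hr
    · subst hr; simp
      ring
    · linear_combination q ^ r * ((q ^ 2) ^ r.choose 2) ^ 2 *
        (2 - (1 - (q ^ 2) ^ r) * heckeCoeff (q ^ 2) (r + 1)) * c3
  have sv := sw.sub su
  -- The difference w - u vanishes at r = 0 and r = 1, as T_1 = 1 and T_2 = 2. For r = n + 2 the
  -- factor 2 - T_{n+3} = -q^{2(n+1)} T_{n+1} (T in base q²) gives the second half of `heckeSum`.
  have e2 : ∑' r, w r = heckeSum (-(q * q ^ 2)) (q ^ 2) := by
    have h1 := sw.tsum_sub su
    have h2 := sv.sum_add_tsum_nat_add 2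
    have h3 : ∑ r ∈ Finset.range 2, (w r - u r) = 0 := by
      rw [Finset.sum_range_succ, Finset.sum_range_one, hv, hv]
      norm_num [heckeCoeff]
    rw [h3, zero_add, h1, eq_sub_iff_add_eq', ← su.tsum_add ((summable_nat_add_iff 2).2 sv)] at h2
    rw [← h2, heckeSum]
    refine tsum_congr fun n => ?_
    have c0 : q * q ^ 2 = q ^ 3 := by ring
    have c1 : (q ^ 3) ^ n * (q ^ 2) ^ (2 * c2 n) =
        q ^ n * (q ^ 2) ^ n.choose 2 * (q ^ 2) ^ (n + 1).choose 2 := by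
      rw [c2_nat, choose_succ_two]
      norm_cast
      ring
    have c2' : (q ^ 3) ^ (-(n : ℤ) - 2) * (q ^ 2) ^ (2 * c2 n + 7 * n + 7) =
        q ^ (n + 2) * (((q ^ 2) ^ (n + 2).choose 2) ^ 2 * (q ^ 2) ^ (n + 1)) := by
      rw [pow_natCast_zpow, pow_natCast_zpow, ← zpow_add₀ hq0, ← pow_mul, ← pow_mul, ← pow_mul,
        ← pow_add, ← pow_add, ← zpow_natCast]
      have h1 := two_mul_c2 n
      have h3 := two_mul_choose_two (n + 2)
      congr 1
      push_cast at h3 ⊢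
      linarith
    rw [hv, if_neg (by omega), show n + 2 + 1 = (n + 1) + 2 from rfl, heckeCoeff.eq_3, hu, neg_neg,
      c0, c1, c2']
    ring
  have e1 : ∀ r : ℕ, (-q) ^ r * (q ^ 2) ^ r.choose 2 * (qPochhammer q (q ^ 2) r *
      qPochhammerInf ((q ^ 2) ^ r * q) (q ^ 2) * baileyZero (q ^ 2) r) =
      qPochhammerInf q (q ^ 2) * w r := fun r => by
    rw [qPochhammer_mul_qPochhammerInf hb1, hw]
    ring
  have h3 := h'.tsum_eq
  rw [tsum_congr e1, tsum_mul_left, e2] at h3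
  have hQ := qPochhammerInf_self_ne_zero hb1
  rw [bigX, h3]
  field_simp

/-! ### Specialisation to the four identities. -/

theorem appellLerchDefined_pow {q : ℂ} (hq0 : q ≠ 0) (hq1 : ‖q‖ < 1) {k m l : ℕ} (hm : m ≠ 0)
    (h1 : ¬ m ∣ l) (h2 : ¬ m ∣ k + l) :
    AppellLerchDefined (q ^ k) (q ^ m) (q ^ l) ∧ AppellLerchDefined (-q ^ k) (q ^ m) (q ^ l) := by
  have hm0 := pow_ne_zero m hq0
  have hm1 := norm_pow_lt_one hq1 hm
  have e1 : ∀ r : ℤ, 1 - (q ^ m) ^ r * q ^ l ≠ 0 := fun r => by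
    rw [pow_natCast_zpow, ← zpow_natCast q l, ← zpow_add₀ hq0]
    refine (one_sub_zpow_ne_zero hq1 fun h => h1 ?_).1
    exact Int.natCast_dvd_natCast.1 ⟨-r, by linear_combination h⟩
  have e2 : ∀ r : ℤ, (q ^ m) ^ (r - 1) * q ^ k * q ^ l = q ^ (m * (r - 1) + (k + l : ℕ)) :=
    fun r => by
    rw [pow_natCast_zpow, zpow_add₀ hq0, zpow_natCast, pow_add, mul_assoc]
  have e3 : ∀ r : ℤ, (m * (r - 1) + (k + l : ℕ) : ℤ) ≠ 0 := fun r h =>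
    h2 (Int.natCast_dvd_natCast.1 ⟨1 - r, by linear_combination h⟩)
  refine ⟨appellLerchDefined_of_ne hm0 hm1 (pow_ne_zero k hq0) (pow_ne_zero l hq0) e1 fun r => ?_,
    appellLerchDefined_of_ne hm0 hm1 (neg_ne_zero.2 (pow_ne_zero k hq0)) (pow_ne_zero l hq0) e1
      fun r => ?_⟩
  · rw [e2]
    exact (one_sub_zpow_ne_zero hq1 (e3 r)).1
  · rw [mul_neg, neg_mul, e2, sub_neg_eq_add]
    exact (one_sub_zpow_ne_zero hq1 (e3 r)).2

theorem one_sub_zpow_div_pow_ne_zero {q : ℂ} (hq0 : q ≠ 0) (hq1 : ‖q‖ < 1) {m k : ℕ} {e : ℤ}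
    (h : m * e ≠ k) : 1 - (q ^ m) ^ e / q ^ k ≠ 0 ∧ 1 - (q ^ m) ^ e / -q ^ k ≠ 0 := by
  rw [pow_natCast_zpow, div_neg, sub_neg_eq_add, ← zpow_natCast q k, ← zpow_sub₀ hq0]
  exact one_sub_zpow_ne_zero hq1 (sub_ne_zero.2 h)

/-- At x = q² the first block dies because j(q²; q²) = 0. With a = 1 the second contains m(q⁻¹, q¹⁰,
q^{±2}): inversion gives z = q^{∓2}, shared with the flip q⁻² ↦ q. -/
theorem phi_eq {q : ℂ} (hq0 : q ≠ 0) (hq1 : ‖q‖ < 1) :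
    phi q = -q⁻¹ * (appellLerch q (q ^ 10) q + appellLerch q (q ^ 10) (q ^ 2)) := by
  have hb0 := pow_ne_zero 2 hq0
  have h10 := pow_ne_zero 10 hq0
  have h11 := norm_pow_lt_one hq1 (k := 10) (by norm_num)
  have hJ : thetaSeries q (q ^ 2) ≠ 0 := fun h => qPochhammerInf_self_ne_zero hq1 (by
    rw [← thetaSeries_self_sq hq0 hq1, h, zero_mul])
  have z1 : thetaSeries (q ^ 2) (q ^ 2) = 0 := by
    simpa using thetaSeries_zpow_eq_zero hb0 1
  have z2 : thetaSeries (q ^ 5 * q ^ 2) (q ^ 2) = -(q ^ 9)⁻¹ * thetaSeries q (q ^ 2) := by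
    rw [show q ^ 5 * q ^ 2 = q ^ 2 * (q ^ 2 * (q ^ 2 * q)) by ring, thetaSeries_mul_left hb0,
      thetaSeries_mul_left hb0, thetaSeries_mul_left hb0 hq0]
    · field_simp
    · exact mul_ne_zero hb0 hq0
    · exact mul_ne_zero hb0 (mul_ne_zero hb0 hq0)
  have m1 : appellLerch ((q ^ 2) ^ 3 / (q ^ 5 * q ^ 2)) ((q ^ 2) ^ 5) ((q ^ 2) ^ (1 : ℤ)) =
      q * appellLerch q (q ^ 10) q := by
    rw [appellLerch_flip h10 h11 hq0 (w := (q ^ 2)⁻¹) (by field_simp),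
      ← appellLerch_inv h10 h11 hq0 (inv_ne_zero hb0), inv_inv, ← pow_mul, zpow_one]
    · congr 1
      · field_simp
      · ring
    · intro r
      simpa [pow_natCast_zpow, zpow_add_one₀ hq0] using
        (one_sub_zpow_ne_zero hq1 (k := 10 * r + 1) (by omega)).1
    · intro r
      have := (one_sub_zpow_div_pow_ne_zero hq0 hq1 (m := 10) (k := 2) (e := r)
        (by push_cast; omega)).1
      rwa [div_eq_mul_inv] at this
  have m2 : appellLerch ((q ^ 2) ^ 3 / (q ^ 5 * q ^ 2)) ((q ^ 2) ^ 5) ((q ^ 2) ^ (-1 : ℤ)) =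
      q * appellLerch q (q ^ 10) (q ^ 2) := by
    rw [← appellLerch_inv h10 h11 hq0 hb0, ← pow_mul, zpow_neg_one]
    congr 1
    · field_simp
    · ring
  refine mul_left_cancel₀ hJ ?_
  rw [(hasSum_phi hq0 hq1).2, heckeSum_eq_add hq0 hq1 hb0 (a := 1) (by norm_num), z1, z2, m1, m2]
  · field_simp
    ring
  · exact fun r => (one_sub_zpow_div_pow_ne_zero hq0 hq1 (by push_cast; omega)).1
  · exact fun r => (one_sub_zpow_div_pow_ne_zero hq0 hq1 (by push_cast; omega)).1
  · rw [← pow_add]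
    exact fun r => (one_sub_zpow_div_pow_ne_zero hq0 hq1 (by push_cast; omega)).1
  · rw [← pow_add]
    exact fun r => (one_sub_zpow_div_pow_ne_zero hq0 hq1 (by push_cast; omega)).1

/-- At x = q³ the second block dies because j(q⁸; q²) = 0. With a = 2 the first contains m(q³, q¹⁰,
q^{±4}): the flip sends q⁻⁴ to q, and q⁴ to q⁻⁷, equivalent to q³. -/
theorem psi_eq {q : ℂ} (hq0 : q ≠ 0) (hq1 : ‖q‖ < 1) :
    psi q = -appellLerch (q ^ 3) (q ^ 10) q - appellLerch (q ^ 3) (q ^ 10) (q ^ 3) := by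
  have hb0 := pow_ne_zero 2 hq0
  have h30 := pow_ne_zero 3 hq0
  have h10 := pow_ne_zero 10 hq0
  have h11 := norm_pow_lt_one hq1 (k := 10) (by norm_num)
  have hJ : thetaSeries q (q ^ 2) ≠ 0 := fun h => qPochhammerInf_self_ne_zero hq1 (by
    rw [← thetaSeries_self_sq hq0 hq1, h, zero_mul])
  have z1 : thetaSeries (q ^ 3) (q ^ 2) = -q⁻¹ * thetaSeries q (q ^ 2) := by
    rw [show q ^ 3 = q ^ 2 * q by ring, thetaSeries_mul_left hb0 hq0]
  have z2 : thetaSeries (q ^ 5 * q ^ 3) (q ^ 2) = 0 := by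
    rw [show q ^ 5 * q ^ 3 = (q ^ 2) ^ (4 : ℤ) by norm_cast; ring]
    exact thetaSeries_zpow_eq_zero hb0 4
  have x1 : (q ^ 2) ^ 3 / q ^ 3 = q ^ 3 := by field_simp
  have m1 : appellLerch ((q ^ 2) ^ 3 / q ^ 3) ((q ^ 2) ^ 5) ((q ^ 2) ^ (2 : ℤ)) =
      appellLerch (q ^ 3) (q ^ 10) (q ^ 3) := by
    rw [appellLerch_flip h10 h11 h30 (w := (q ^ 6)⁻¹) (by field_simp),
      ← appellLerch_mul_left h10 h11 _ (inv_ne_zero (pow_ne_zero 6 hq0)), x1, ← pow_mul]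
    · congr 1
      norm_cast
      field_simp
    · intro r
      have := (one_sub_zpow_ne_zero hq1 (k := 10 * r + (3 : ℕ)) (by push_cast; omega)).1
      rwa [zpow_add₀ hq0, zpow_natCast, ← Nat.cast_ofNat (R := ℤ) (n := 10),
        ← pow_natCast_zpow] at this
    · intro r
      have := (one_sub_zpow_div_pow_ne_zero hq0 hq1 (m := 10) (k := 6) (e := r)
        (by push_cast; omega)).1
      rwa [div_eq_mul_inv] at this
  have m2 : appellLerch ((q ^ 2) ^ 3 / q ^ 3) ((q ^ 2) ^ 5) ((q ^ 2) ^ (-2 : ℤ)) =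
      appellLerch (q ^ 3) (q ^ 10) q := by
    rw [appellLerch_flip h10 h11 hq0 (w := (q ^ 4)⁻¹) (by field_simp), x1, ← pow_mul]
    · congr 1
      rw [zpow_neg]
      norm_cast
      ring
    · intro r
      simpa [pow_natCast_zpow, zpow_add_one₀ hq0] using
        (one_sub_zpow_ne_zero hq1 (k := 10 * r + 1) (by omega)).1
    · intro r
      have := (one_sub_zpow_div_pow_ne_zero hq0 hq1 (m := 10) (k := 4) (e := r)
        (by push_cast; omega)).1
      rwa [div_eq_mul_inv] at this
  refine mul_left_cancel₀ hJ ?_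
  rw [(hasSum_psi hq0 hq1).2, heckeSum_eq_add hq0 hq1 h30 (a := 2) (by norm_num), z1, z2, m1, m2]
  · field_simp
    ring
  · exact fun r => (one_sub_zpow_div_pow_ne_zero hq0 hq1 (by push_cast; omega)).1
  · exact fun r => (one_sub_zpow_div_pow_ne_zero hq0 hq1 (by push_cast; omega)).1
  · rw [← pow_add]
    exact fun r => (one_sub_zpow_div_pow_ne_zero hq0 hq1 (by push_cast; omega)).1
  · rw [← pow_add]
    exact fun r => (one_sub_zpow_div_pow_ne_zero hq0 hq1 (by push_cast; omega)).1

/-- Here y = q and a = 1, with z = q⁻¹ moved to q⁴ by the period q⁵. -/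
theorem bigX_eq {q : ℂ} (hq0 : q ≠ 0) (hq1 : ‖q‖ < 1) :
    bigX q = appellLerch (-q ^ 2) (q ^ 5) q + appellLerch (-q ^ 2) (q ^ 5) (q ^ 4) := by
  have hQ := qPochhammerInf_self_ne_zero (norm_pow_lt_one hq1 (k := 2) two_ne_zero)
  have h50 := pow_ne_zero 5 hq0
  have h51 := norm_pow_lt_one hq1 (k := 5) (by norm_num)
  have hne : ∀ a : ℤ, ¬ 5 ∣ a - 3 → ∀ r : ℤ,
      1 - q ^ (a - 2 + 5 * r) / q ≠ 0 ∧ 1 - q ^ (a - 2 + 5 * r) / -q ≠ 0 := fun a ha r => by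
    simpa using one_sub_zpow_div_pow_ne_zero hq0 hq1 (m := 1) (k := 1) (e := a - 2 + 5 * r)
      (by push_cast; omega)
  have h := heckeSum_sq_eq hq0 hq1 hq0 (a := 1) (by norm_num)
    (by simpa using thetaSeries_zpow_eq_zero hq0 1)
    (fun r => (hne 1 (by norm_num) r).1) (fun r => (hne (-1) (by norm_num) r).1)
    (fun r => (hne 1 (by norm_num) r).2) (fun r => (hne (-1) (by norm_num) r).2)
  have x1 : q ^ 3 / -q = -q ^ 2 := by field_simp
  have m1 : appellLerch (-q ^ 2) (q ^ 5) (q ^ (-1 : ℤ)) =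
      appellLerch (-q ^ 2) (q ^ 5) (q ^ 4) := by
    rw [← appellLerch_mul_left h50 h51 _ (zpow_ne_zero _ hq0)]
    congr 1
    rw [zpow_neg_one]
    field_simp
  rw [x1, m1, zpow_one] at h
  refine mul_left_cancel₀ hQ ?_
  rw [(hasSum_bigX hq0 hq1).2]
  linear_combination qPochhammerInf q (q ^ 2) / 2 * h +
    (appellLerch (-q ^ 2) (q ^ 5) q + appellLerch (-q ^ 2) (q ^ 5) (q ^ 4)) / 2 *
      thetaSeries_neg_self hq0 hq1

/-- Here y = q² and a = 2, with z = q⁻² moved to q³ by the period q⁵. -/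
theorem chi_eq {q : ℂ} (hq0 : q ≠ 0) (hq1 : ‖q‖ < 1) :
    chi q = appellLerch (-q) (q ^ 5) (q ^ 2) + appellLerch (-q) (q ^ 5) (q ^ 3) := by
  have hQ := qPochhammerInf_self_ne_zero (norm_pow_lt_one hq1 (k := 2) two_ne_zero)
  have h50 := pow_ne_zero 5 hq0
  have h51 := norm_pow_lt_one hq1 (k := 5) (by norm_num)
  have hne : ∀ a : ℤ, ¬ 5 ∣ a - 4 → ∀ r : ℤ,
      1 - q ^ (a - 2 + 5 * r) / q ^ 2 ≠ 0 ∧ 1 - q ^ (a - 2 + 5 * r) / -q ^ 2 ≠ 0 :=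
    fun a ha r => by
    simpa using one_sub_zpow_div_pow_ne_zero hq0 hq1 (m := 1) (k := 2) (e := a - 2 + 5 * r)
      (by push_cast; omega)
  have h := heckeSum_sq_eq hq0 hq1 (pow_ne_zero 2 hq0) (a := 2) (by norm_num)
    (by simpa using thetaSeries_zpow_eq_zero hq0 ((2 : ℕ) : ℤ))
    (fun r => (hne 2 (by norm_num) r).1) (fun r => (hne (-2) (by norm_num) r).1)
    (fun r => (hne 2 (by norm_num) r).2) (fun r => (hne (-2) (by norm_num) r).2)
  have x1 : q ^ 3 / -q ^ 2 = -q := by field_simp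
  have m1 : appellLerch (-q) (q ^ 5) (q ^ (-2 : ℤ)) = appellLerch (-q) (q ^ 5) (q ^ 3) := by
    rw [← appellLerch_mul_left h50 h51 _ (zpow_ne_zero _ hq0)]
    congr 1
    rw [zpow_neg]
    norm_cast
    field_simp
  have z1 : thetaSeries (-q ^ 2) q = q⁻¹ * thetaSeries (-q) q := by
    rw [show -q ^ 2 = q * -q by ring, thetaSeries_mul_left hq0 (neg_ne_zero.2 hq0), inv_neg,
      neg_neg]
  have m2 : appellLerch (-q) (q ^ 5) (q ^ (2 : ℤ)) = appellLerch (-q) (q ^ 5) (q ^ 2) := by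
    norm_cast
  rw [x1, m1, m2, z1] at h
  refine mul_left_cancel₀ hQ ?_
  have k := thetaSeries_neg_self hq0 hq1
  have hqi : q * q⁻¹ = 1 := mul_inv_cancel₀ hq0
  rw [(hasSum_chi hq0 hq1).2]
  linear_combination q * qPochhammerInf q (q ^ 2) / 2 * h +
    (appellLerch (-q) (q ^ 5) (q ^ 2) + appellLerch (-q) (q ^ 5) (q ^ 3)) / 2 *
      (k + qPochhammerInf q (q ^ 2) * thetaSeries (-q) q * hqi)

end

end MockTheta

theorem mainTheorem7 (q : ℂ) (hq0 : q ≠ 0) (hq1 : ‖q‖ < 1) :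
    (Summable (MockTheta.phiTerm q) ∧
      MockTheta.AppellLerchDefined q (q ^ 10) q ∧
      MockTheta.AppellLerchDefined q (q ^ 10) (q ^ 2) ∧
      MockTheta.phi q =
        -q⁻¹ * (MockTheta.appellLerch q (q ^ 10) q +
          MockTheta.appellLerch q (q ^ 10) (q ^ 2))) ∧
    (Summable (MockTheta.psiTerm q) ∧
      MockTheta.AppellLerchDefined (q ^ 3) (q ^ 10) q ∧
      MockTheta.AppellLerchDefined (q ^ 3) (q ^ 10) (q ^ 3) ∧
      MockTheta.psi q =
        -MockTheta.appellLerch (q ^ 3) (q ^ 10) q -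
          MockTheta.appellLerch (q ^ 3) (q ^ 10) (q ^ 3)) ∧
    (Summable (MockTheta.bigXTerm q) ∧
      MockTheta.AppellLerchDefined (-q ^ 2) (q ^ 5) q ∧
      MockTheta.AppellLerchDefined (-q ^ 2) (q ^ 5) (q ^ 4) ∧
      MockTheta.bigX q =
        MockTheta.appellLerch (-q ^ 2) (q ^ 5) q +
          MockTheta.appellLerch (-q ^ 2) (q ^ 5) (q ^ 4)) ∧
    (Summable (MockTheta.chiTerm q) ∧
      MockTheta.AppellLerchDefined (-q) (q ^ 5) (q ^ 2) ∧
      MockTheta.AppellLerchDefined (-q) (q ^ 5) (q ^ 3) ∧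
      MockTheta.chi q =
        MockTheta.appellLerch (-q) (q ^ 5) (q ^ 2) +
          MockTheta.appellLerch (-q) (q ^ 5) (q ^ 3)) := by
  refine ⟨⟨(MockTheta.hasSum_phi hq0 hq1).1,
      by simpa using (MockTheta.appellLerchDefined_pow hq0 hq1 (k := 1) (m := 10) (l := 1)
        (by norm_num) (by norm_num) (by norm_num)).1,
      by simpa using (MockTheta.appellLerchDefined_pow hq0 hq1 (k := 1) (m := 10) (l := 2)
        (by norm_num) (by norm_num) (by norm_num)).1,
      MockTheta.phi_eq hq0 hq1⟩,
    ⟨(MockTheta.hasSum_psi hq0 hq1).1,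
      by simpa using (MockTheta.appellLerchDefined_pow hq0 hq1 (k := 3) (m := 10) (l := 1)
        (by norm_num) (by norm_num) (by norm_num)).1,
      by simpa using (MockTheta.appellLerchDefined_pow hq0 hq1 (k := 3) (m := 10) (l := 3)
        (by norm_num) (by norm_num) (by norm_num)).1,
      MockTheta.psi_eq hq0 hq1⟩,
    ⟨(MockTheta.hasSum_bigX hq0 hq1).1,
      by simpa using (MockTheta.appellLerchDefined_pow hq0 hq1 (k := 2) (m := 5) (l := 1)
        (by norm_num) (by norm_num) (by norm_num)).2,
      by simpa using (MockTheta.appellLerchDefined_pow hq0 hq1 (k := 2) (m := 5) (l := 4)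
        (by norm_num) (by norm_num) (by norm_num)).2,
      MockTheta.bigX_eq hq0 hq1⟩,
    ⟨(MockTheta.hasSum_chi hq0 hq1).1,
      by simpa using (MockTheta.appellLerchDefined_pow hq0 hq1 (k := 1) (m := 5) (l := 2)
        (by norm_num) (by norm_num) (by norm_num)).2,
      by simpa using (MockTheta.appellLerchDefined_pow hq0 hq1 (k := 1) (m := 5) (l := 3)
        (by norm_num) (by norm_num) (by norm_num)).2,
      MockTheta.chi_eq hq0 hq1⟩⟩
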